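/- Let $g\ge 2$ and $n\ge 1$, let $S_g$ be a closed, connected, orientable surface of genus $g$, and let $S_{g,n}=S_g\smallsetminus\{p_1,\dots,p_n\}$ be the surface obtained by puncturing $S_g$ at $n$ distinct points. Let $\mathrm{Mod}(S_g)$ be the group of isotopy classes of orientation-preserving homeomorphisms of $S_g$, and let $\mathrm{PMod}(S_{g,n})$ be the pure mapping class group of $S_{g,n}$, that is, the group of orientation-preserving homeomorphisms of $S_g$ fixing each $p_i$, modulo isotopy through homeomorphisms fixing each $p_i$. Let the pure surface braid group $\mathrm{PB}_n(S_g)$ be the kernel of the homomorphism $\mathrm{PMod}(S_{g,n})\to\mathrm{Mod}(S_g)$ that fills in the punctures. For $f\in\mathrm{PMod}(S_{g,n})$ let $\kappa(f)$ denote the dimension of the subspace $\{v\in H_1(S_{g,n};\mathbb R) : f_*v=v\}$ of the first singular homology of $S_{g,n}$ with real coefficients. Then for every $f\in \mathrm{PB}_n(S_g)$, $$\max\{2g,\;n-1\}\le\kappa(f).$$ -/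

import Mathlib

noncomputable section

namespace SurfaceBraid

open AlgebraicTopology

/-! ## The closed surface of genus `g` -/

/-- The point of the closed unit disc with boundary parameter `s / (4 g)` of a full turn. For
`k = 0, …, 4 g - 1` the point with `s = k` is the `k`-th vertex of the `4 g`-gon, and
`s ∈ [k, k + 1]` runs through its `k`-th side. -/
def boundaryPoint (g : ℕ) (s : ℝ) : Metric.closedBall (0 : ℂ) 1 :=
  ⟨Complex.exp (((2 * Real.pi * s / (4 * g) : ℝ) : ℂ) * Complex.I), by
    rw [mem_closedBall_zero_iff, Complex.norm_exp_ofReal_mul_I]⟩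

/-- The side identifications of the `4 g`-gon with boundary word
`a₁ b₁ a₁⁻¹ b₁⁻¹ ⋯ a_g b_g a_g⁻¹ b_g⁻¹`. -/
inductive SideGluing (g : ℕ) :
    Metric.closedBall (0 : ℂ) 1 → Metric.closedBall (0 : ℂ) 1 → Prop
  | a (i : Fin g) (t : ℝ) (ht : t ∈ Set.Icc (0 : ℝ) 1) :
      SideGluing g (boundaryPoint g (4 * (i : ℕ) + t)) (boundaryPoint g (4 * (i : ℕ) + 3 - t))
  | b (i : Fin g) (t : ℝ) (ht : t ∈ Set.Icc (0 : ℝ) 1) :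
      SideGluing g (boundaryPoint g (4 * (i : ℕ) + 1 + t)) (boundaryPoint g (4 * (i : ℕ) + 4 - t))

/-- The standard closed orientable surface of genus `g ≥ 1`: the quotient of the disc (a
`4 g`-gon) by the equivalence relation generated by the side identifications. -/
def PolygonSurface (g : ℕ) : Type := Quot (SideGluing g)

instance (g : ℕ) : TopologicalSpace (PolygonSurface g) :=
  inferInstanceAs (TopologicalSpace (Quot (SideGluing g)))

/-- `S` is a closed orientable surface of genus `g` (for `g ≥ 1`). -/
def HasGenus (S : Type) [TopologicalSpace S] (g : ℕ) : Prop :=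
  Nonempty (S ≃ₜ PolygonSurface g)

/-! ## Singular homology -/

/-- The singular homology `H_k(X; R)`. -/
abbrev H (R : Type) [CommRing R] (k : ℕ) (X : Type) [TopologicalSpace X] : ModuleCat.{0} R :=
  ((singularHomologyFunctor (ModuleCat.{0} R) k).obj (ModuleCat.of R R)).obj (TopCat.of X)

/-- The map induced on singular homology by a continuous map. -/
def Hmap (R : Type) [CommRing R] (k : ℕ) {X Y : Type} [TopologicalSpace X] [TopologicalSpace Y]
    (φ : C(X, Y)) : H R k X →ₗ[R] H R k Y :=
  (((singularHomologyFunctor (ModuleCat.{0} R) k).obj (ModuleCat.of R R)).map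
    (TopCat.ofHom φ)).hom

theorem Hmap_id (R : Type) [CommRing R] (k : ℕ) (X : Type) [TopologicalSpace X] :
    Hmap R k (ContinuousMap.id X) = LinearMap.id := by
  unfold Hmap
  rw [TopCat.ofHom_id, CategoryTheory.Functor.map_id, ModuleCat.hom_id]

theorem Hmap_comp (R : Type) [CommRing R] (k : ℕ) {X Y Z : Type} [TopologicalSpace X]
    [TopologicalSpace Y] [TopologicalSpace Z] (ψ : C(Y, Z)) (φ : C(X, Y)) :
    Hmap R k (ψ.comp φ) = Hmap R k ψ ∘ₗ Hmap R k φ := by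
  unfold Hmap
  rw [TopCat.ofHom_comp, CategoryTheory.Functor.map_comp, ModuleCat.hom_comp]

theorem Hmap_eq_of_homotopic (R : Type) [CommRing R] (k : ℕ) {X Y : Type} [TopologicalSpace X]
    [TopologicalSpace Y] {φ ψ : C(X, Y)} (h : φ.Homotopic ψ) : Hmap R k φ = Hmap R k ψ := by
  obtain ⟨F⟩ := h
  have F' : TopCat.Homotopy (TopCat.ofHom φ) (TopCat.ofHom ψ) := F
  have := F'.congr_homologyMap_singularChainComplexFunctor (ModuleCat.of R R) k
  exact congrArg ModuleCat.Hom.hom this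

/-! ## Mapping classes of a surface with marked points -/

variable {S : Type} [TopologicalSpace S] {n : ℕ}

/-- A self-homeomorphism of a closed connected orientable surface `S` preserves orientation iff
it preserves the fundamental class, i.e. acts trivially on `H_2(S; ℤ) ≅ ℤ`. -/
def OrientationPreserving (φ : S ≃ₜ S) : Prop :=
  Hmap ℤ 2 (φ : C(S, S)) = LinearMap.id

/-- The orientation preserving homeomorphisms of `S` that fix each of the points `p i`;
equivalently, those of the punctured surface `S ∖ {p i}` that fix each puncture. -/
def PHomeo (p : Fin n → S) : Subgroup (S ≃ₜ S) where
  carrier := {φ | OrientationPreserving φ ∧ ∀ i, φ (p i) = p i}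
  one_mem' := ⟨Hmap_id ℤ 2 S, fun _ => rfl⟩
  mul_mem' := by
    rintro φ ψ ⟨hφ, hφp⟩ ⟨hψ, hψp⟩
    refine ⟨?_, fun i => ?_⟩
    · have := Hmap_comp ℤ 2 (φ : C(S, S)) (ψ : C(S, S))
      unfold OrientationPreserving at *
      rw [hφ, hψ] at this
      exact this
    · rw [Homeomorph.mul_apply, hψp, hφp]
  inv_mem' := by
    rintro φ ⟨hφ, hφp⟩
    refine ⟨?_, fun i => ?_⟩
    · have h := Hmap_comp ℤ 2 (φ : C(S, S)) (φ.symm : C(S, S))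
      have e : (φ : C(S, S)).comp (φ.symm : C(S, S)) = ContinuousMap.id S := by
        ext x; exact φ.apply_symm_apply x
      unfold OrientationPreserving at *
      rw [e, hφ, Hmap_id, LinearMap.id_comp] at h
      exact h.symm
    · rw [Homeomorph.inv_apply, Homeomorph.symm_apply_eq, hφp]

/-- `φ` is isotopic to the identity, through homeomorphisms that fix each of the points `p i`. -/
def IsotopicToId (p : Fin n → S) (φ : S ≃ₜ S) : Prop :=
  ∃ F : unitInterval → (S ≃ₜ S), Continuous (fun q : unitInterval × S => F q.1 q.2) ∧
    F 0 = 1 ∧ F 1 = φ ∧ ∀ t i, F t (p i) = p i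

/-- The subgroup of the homeomorphisms that are isotopic to the identity relative to the marked
points. -/
def PHomeo₀ (p : Fin n → S) : Subgroup (PHomeo p) where
  carrier := {φ | IsotopicToId p (φ : S ≃ₜ S)}
  one_mem' := ⟨fun _ => 1, continuous_snd, rfl, rfl, fun _ _ => rfl⟩
  mul_mem' := by
    rintro φ ψ ⟨F, hF, hF0, hF1, hFp⟩ ⟨G, hG, hG0, hG1, hGp⟩
    refine ⟨fun t => F t * G t, ?_, ?_, ?_, fun t i => ?_⟩
    · exact hF.comp (continuous_fst.prodMk hG)
    · simp only [hF0, hG0, one_mul]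
    · simp only [hF1, hG1, Subgroup.coe_mul]
    · rw [Homeomorph.mul_apply, hGp, hFp]
  inv_mem' := by
    rintro φ ⟨F, hF, hF0, hF1, hFp⟩
    refine ⟨fun t => F (unitInterval.symm t) * (φ : S ≃ₜ S)⁻¹, ?_, ?_, ?_, fun t i => ?_⟩
    · exact hF.comp ((unitInterval.continuous_symm.comp continuous_fst).prodMk
        (((φ : S ≃ₜ S)⁻¹).continuous.comp continuous_snd))
    · simp only [unitInterval.symm_zero, hF1, mul_inv_cancel]
    · simp only [unitInterval.symm_one, hF0, one_mul, Subgroup.coe_inv]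
    · rw [Homeomorph.mul_apply, ← Subgroup.coe_inv, (φ⁻¹).2.2 i, hFp]

instance (p : Fin n → S) : (PHomeo₀ p).Normal where
  conj_mem := by
    rintro φ ⟨F, hF, hF0, hF1, hFp⟩ ψ
    refine ⟨fun t => (ψ : S ≃ₜ S) * F t * (ψ : S ≃ₜ S)⁻¹, ?_, ?_, ?_, fun t i => ?_⟩
    · exact (ψ : S ≃ₜ S).continuous.comp (hF.comp (continuous_fst.prodMk
        (((ψ : S ≃ₜ S)⁻¹).continuous.comp continuous_snd)))
    · simp only [hF0, mul_one, mul_inv_cancel]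
    · simp only [hF1, Subgroup.coe_mul, Subgroup.coe_inv]
    · rw [Homeomorph.mul_apply, Homeomorph.mul_apply, ← Subgroup.coe_inv, (ψ⁻¹).2.2 i, hFp, ψ.2.2 i]

/-- The pure mapping class group of `S` with the punctures (marked points) `p i`. -/
abbrev PMod (p : Fin n → S) : Type := PHomeo p ⧸ PHomeo₀ p

/-- The empty family of marked points. -/
def noPoints (S : Type) : Fin 0 → S := Fin.elim0

/-- The mapping class group of the closed surface `S`. -/
abbrev Mod (S : Type) [TopologicalSpace S] : Type := PMod (noPoints S)

/-- The forgetful homomorphism `PMod(S, p) → Mod(S)` that fills in the punctures. -/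
def forget (p : Fin n → S) : PMod p →* Mod S :=
  QuotientGroup.map (PHomeo₀ p) (PHomeo₀ (noPoints S))
    (Subgroup.inclusion fun _ hφ => ⟨hφ.1, fun i => i.elim0⟩)
    (by
      rintro φ ⟨F, hF, hF0, hF1, -⟩
      exact ⟨F, hF, hF0, hF1, fun _ i => i.elim0⟩)

/-- The pure braid group `PB_n(S)`: the kernel of the forgetful homomorphism. -/
def PB (p : Fin n → S) : Subgroup (PMod p) := (forget p).ker

/-! ## The action on the homology of the punctured surface -/

/-- The punctured surface `S ∖ {p i}`. -/
abbrev Punctured (p : Fin n → S) : Type := {x : S // x ∉ Set.range p}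

/-- The restriction of a homeomorphism fixing the points `p i` to the punctured surface. -/
def restrict (p : Fin n → S) (φ : S ≃ₜ S) (h : ∀ i, φ (p i) = p i) :
    C(Punctured p, Punctured p) where
  toFun x := ⟨φ x.1, fun hx => x.2 (hx.imp fun i hi => φ.injective ((h i).trans hi))⟩
  continuous_toFun := (φ.continuous.comp continuous_subtype_val).subtype_mk _

/-- The action of the pure homeomorphisms on `H_1(S ∖ {p i}; ℝ)`. -/
def homeoAction (p : Fin n → S) : PHomeo p →* Module.End ℝ (H ℝ 1 (Punctured p)) where
  toFun φ := Hmap ℝ 1 (restrict p φ φ.2.2)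
  map_one' := Hmap_id ℝ 1 (Punctured p)
  map_mul' φ ψ := Hmap_comp ℝ 1 (restrict p φ φ.2.2) (restrict p ψ ψ.2.2)

/-- The action of the pure mapping class group on `H_1(S ∖ {p i}; ℝ)`. -/
def homologyAction (p : Fin n → S) : PMod p →* Module.End ℝ (H ℝ 1 (Punctured p)) :=
  QuotientGroup.lift (PHomeo₀ p) (homeoAction p) (by
    rintro φ ⟨F, hF, hF0, hF1, hFp⟩
    refine Eq.trans (Eq.symm ?_) (Hmap_id ℝ 1 (Punctured p))
    refine Hmap_eq_of_homotopic ℝ 1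
      ⟨⟨⟨fun q => restrict p (F q.1) (hFp q.1) q.2, ?_⟩, ?_, ?_⟩⟩
    · exact (hF.comp (continuous_fst.prodMk
        (continuous_subtype_val.comp continuous_snd))).subtype_mk _
    · intro x
      apply Subtype.ext
      change F 0 x.1 = x.1
      rw [hF0, Homeomorph.one_apply]
    · intro x
      apply Subtype.ext
      change F 1 x.1 = (φ : S ≃ₜ S) x.1
      rw [hF1])

/-- The subspace of `H_1(S ∖ {p i}; ℝ)` fixed by the mapping class `f`. -/
def fixedSubspace (p : Fin n → S) (f : PMod p) : Submodule ℝ (H ℝ 1 (Punctured p)) :=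
  LinearMap.eqLocus (homologyAction p f) LinearMap.id

/-- `κ(f)`: the dimension of the subspace of `H_1(S ∖ {p i}; ℝ)` fixed by `f`. -/
def kappa (p : Fin n → S) (f : PMod p) : Cardinal := Module.rank ℝ (fixedSubspace p f)

end SurfaceBraid

end

/-!
Let `P` be the set of punctures, `V = H₁(S ∖ P; ℝ)`, let `ι : V → H₁(S; ℝ)` be induced by the
inclusion and `φ` the action of a pure braid on `V`. As the underlying homeomorphism is isotopic to
the identity in `S`, `ι ∘ φ = ι`. The bound follows by linear algebra (`max_rank_le_rank_eqLocus`)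
from three facts:

* `φ` is the identity on `ker ι` (`Hmap_eq_self_of_mem_ker`), so `κ ≥ dim ker ι`; moreover `φ - 1`
  has image in `ker ι`, so that `κ ≥ dim V - dim ker ι = dim range ι` when `ker ι` has finite
  dimension;
* `dim ker ι ≥ n - 1` (`exists_dual_independent_of_poles`);
* `dim range ι ≥ 2 g` (`exists_dual_independent_of_cocycles`).

All three are proved on the dual side. A functional on `H₁(X; ℝ)` is represented by a function
`D : X → X → ℝ` that satisfies the additive cocycle relation near the diagonal (`CocycleAt`); it
plays the role of a closed `1`-form, `D x y` being the increment of a local primitive from `x` to a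
nearby point `y`. The functional is then integration of `D` (`IsPeriod`, `exists_isPeriod`,
`exists_cocycle_isPeriod`), and it vanishes if and only if `D` has a global potential
(`IsPeriod.exists_potential`, `IsPeriod.eq_zero`).

A cocycle `D` on a punctured disc is, up to a potential, a multiple of the angle
(`IsDiscChart.exists_residue`), the multiple being its residue, and `D` extends over the puncture
when it is `ResidueFree` there (`ResidueFree.exists_extension`). On `S` the residue theorem holds: a
single singularity has no residue. For the centre of the polygon this is
`residueTheorem_polygon`, because the boundary word is a product of commutators, and from there it
spreads over the connected surface along dipoles (`ResidueTheorem.forall`). Consequences: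

* For any two points there is a cocycle with singularities exactly there (`exists_hasPole`,
  `HasPole.not_residueFree`). The cocycles with poles at one fixed puncture and at one of the other
  `n - 1` punctures give independent functionals on `ker ι`: a combination that factors through `ι`
  extends over `P` up to a potential, hence has no residues.
* The surface is orientable, in the form of a coherent choice of angle germs
  (`exists_isOrientation`). By homotopy invariance of winding numbers, a homeomorphism isotopic to
  the identity therefore preserves residues at its fixed points
  (`IsOrientation.residueFree_pullback_sub`). Hence `φ^* D - D` extends over `P` for every cocycle
  `D` on `S ∖ P`, and its integrals vanish on `ker ι`.

Finally, `2 g` independent cocycles on `S` come from circle valued functions on the polygon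
(`surfacePhase_independent`), and they stay independent on `S ∖ P` because a potential on `S ∖ P` of
a cocycle on `S` extends over the punctures (`exists_potential_of_compl`).
-/

noncomputable section

namespace SurfaceBraid

open AlgebraicTopology CategoryTheory Topology Filter

/-! ### Singular cocycles of degree one and functionals on `H₁` -/

theorem exists_linear_comp_eq {V W U : Type*} [AddCommGroup V] [Module ℝ V] [AddCommGroup W]
    [Module ℝ W] [AddCommGroup U] [Module ℝ U] (f : V →ₗ[ℝ] W) (g : V →ₗ[ℝ] U)
    (h : LinearMap.ker f ≤ LinearMap.ker g) : ∃ m : W →ₗ[ℝ] U, m ∘ₗ f = g := by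
  obtain ⟨s, hs⟩ := f.rangeRestrict.exists_rightInverse_of_surjective f.range_rangeRestrict
  obtain ⟨m, hm⟩ := LinearMap.exists_extend (g ∘ₗ s)
  refine ⟨m, LinearMap.ext fun v => ?_⟩
  have h1 : m (f v) = g (s (f.rangeRestrict v)) := LinearMap.congr_fun hm (f.rangeRestrict v)
  have h2 : f (s (f.rangeRestrict v) - v) = 0 := by
    have := congrArg Subtype.val (LinearMap.congr_fun hs (f.rangeRestrict v))
    rw [map_sub, sub_eq_zero]
    exact this
  have h3 := h h2
  rw [LinearMap.mem_ker, map_sub, sub_eq_zero] at h3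
  rw [LinearMap.comp_apply, h1, h3]

theorem exists_comp_eq_of_ker_le {V W U : ModuleCat.{0} ℝ} (f : V ⟶ W) (g : V ⟶ U)
    (h : LinearMap.ker f.hom ≤ LinearMap.ker g.hom) : ∃ m : W ⟶ U, f ≫ m = g := by
  obtain ⟨m, hm⟩ := exists_linear_comp_eq _ _ h
  exact ⟨ModuleCat.ofHom m, ModuleCat.hom_ext hm⟩

/-- A functional on `1`-chains that vanishes on the cycles factors through the boundary map. -/
theorem exists_d_comp_eq (K : ChainComplex (ModuleCat.{0} ℝ) ℕ) {A : ModuleCat.{0} ℝ}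
    (k : K.X 1 ⟶ A) (hk : K.iCycles 1 ≫ k = 0) : ∃ m : K.X 0 ⟶ A, K.d 1 0 ≫ m = k := by
  have hker : LinearMap.ker (K.d 1 0).hom ≤ LinearMap.ker k.hom := by
    intro c hc
    have hc' : ModuleCat.ofHom (LinearMap.toSpanSingleton ℝ (K.X 1) c) ≫ K.d 1 0 = 0 := by
      ext
      simpa using hc
    have h2 : K.liftCycles (ModuleCat.ofHom (LinearMap.toSpanSingleton ℝ (K.X 1) c)) 0
        (by simp) hc' ≫ K.iCycles 1 ≫ k = 0 := by
      rw [hk, Limits.comp_zero]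
    rw [HomologicalComplex.liftCycles_i_assoc] at h2
    have h3 := LinearMap.congr_fun (congrArg ModuleCat.Hom.hom h2) (1 : ℝ)
    simpa using h3
  exact exists_comp_eq_of_ker_le _ _ hker

/-- Every functional on the first homology is induced by a functional on `1`-chains. -/
theorem exists_homologyι_descOpcycles_eq (K : ChainComplex (ModuleCat.{0} ℝ) ℕ)
    {A : ModuleCat.{0} ℝ} (u : K.homology 1 ⟶ A) :
    ∃ (k : K.X 1 ⟶ A) (hk : K.d 2 1 ≫ k = 0),
      K.homologyι 1 ≫ K.descOpcycles k 2 (by simp) hk = u := by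
  have hker : LinearMap.ker (K.homologyι 1).hom ≤ LinearMap.ker u.hom := by
    rw [(ModuleCat.mono_iff_ker_eq_bot _).1 inferInstance]
    exact bot_le
  obtain ⟨m, hm⟩ := exists_comp_eq_of_ker_le _ _ hker
  have hd : K.d 2 1 ≫ K.pOpcycles 1 ≫ m = 0 := by
    rw [← Category.assoc, HomologicalComplex.d_pOpcycles, Limits.zero_comp]
  refine ⟨K.pOpcycles 1 ≫ m, hd, ?_⟩
  have : K.descOpcycles (K.pOpcycles 1 ≫ m) 2 (by simp) hd = m := by
    rw [← cancel_epi (K.pOpcycles 1), HomologicalComplex.p_descOpcycles]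
  rw [this, hm]

/-- The face inclusion of the standard edge into the standard triangle that misses vertex `i`. -/
def edgeFace (i : Fin 3) : C(stdSimplex ℝ (Fin 2), stdSimplex ℝ (Fin 3)) :=
  ⟨_, stdSimplex.continuous_map i.succAbove⟩

/-- The vertices of the standard edge. -/
abbrev edgeVertex (i : Fin 2) : stdSimplex ℝ (Fin 2) := stdSimplex.vertex i

/-- The real singular `1`-cocycles of `X`, as functions on the singular `1`-simplices. -/
def singularCocycles (X : Type) [TopologicalSpace X] :
    Submodule ℝ (C(stdSimplex ℝ (Fin 2), X) → ℝ) where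
  carrier := {w | ∀ τ : C(stdSimplex ℝ (Fin 3), X),
    w (τ.comp (edgeFace 0)) - w (τ.comp (edgeFace 1)) + w (τ.comp (edgeFace 2)) = 0}
  zero_mem' := fun _ => by simp
  add_mem' := fun {a b} ha hb τ => by
    have := ha τ
    have := hb τ
    simp only [Pi.add_apply]
    linarith
  smul_mem' := fun c a ha τ => by
    have := ha τ
    simp only [Pi.smul_apply, smul_eq_mul]
    linear_combination c * this

variable {X Y : Type} [TopologicalSpace X] [TopologicalSpace Y]

/-- The singular chain complex of `X` with real coefficients. -/
def singularChains (X : Type) [TopologicalSpace X] : ChainComplex (ModuleCat.{0} ℝ) ℕ :=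
  (TopCat.toSSet.obj (TopCat.of X)).chainComplex (ModuleCat.of ℝ ℝ)

/-- The singular `n`-simplex `σ` as an element of the singular simplicial set. -/
abbrev toSimplex {n : ℕ} (σ : C(stdSimplex ℝ (Fin (n + 1)), X)) :
    (TopCat.toSSet.obj (TopCat.of X)).obj (.op (.mk n)) :=
  (TopCat.toSSetObjEquiv (TopCat.of X) (.op (.mk n))).symm σ

/-- The basis chain given by a singular simplex. -/
def basisChain {n : ℕ} (σ : C(stdSimplex ℝ (Fin (n + 1)), X)) :
    ModuleCat.of ℝ ℝ ⟶ (singularChains X).X n :=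
  SSet.ιChainComplex (R := ModuleCat.of ℝ ℝ) _ (toSimplex σ)

/-- The linear functional on singular `n`-chains with prescribed values on the simplices. -/
def evalChain {n : ℕ} (w : C(stdSimplex ℝ (Fin (n + 1)), X) → ℝ) :
    (singularChains X).X n ⟶ ModuleCat.of ℝ ℝ :=
  Limits.Sigma.desc fun x => ModuleCat.ofHom
    (w (TopCat.toSSetObjEquiv (TopCat.of X) (.op (.mk n)) x) • LinearMap.id)

theorem basisChain_evalChain {n : ℕ} (w : C(stdSimplex ℝ (Fin (n + 1)), X) → ℝ)
    (σ : C(stdSimplex ℝ (Fin (n + 1)), X)) :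
    basisChain σ ≫ evalChain w = ModuleCat.ofHom (w σ • LinearMap.id) := by
  unfold basisChain evalChain SSet.ιChainComplex
  erw [Limits.Sigma.ι_desc]
  rw [Equiv.apply_symm_apply]

theorem chain_hom_ext {n : ℕ} {T : ModuleCat.{0} ℝ} {f g : (singularChains X).X n ⟶ T}
    (h : ∀ σ : C(stdSimplex ℝ (Fin (n + 1)), X), basisChain σ ≫ f = basisChain σ ≫ g) : f = g := by
  refine SSet.chainComplex_hom_ext fun x => ?_
  have := h (TopCat.toSSetObjEquiv (TopCat.of X) (.op (.mk n)) x)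
  unfold basisChain toSimplex at this
  rwa [Equiv.symm_apply_apply] at this

theorem basisChain_d_two (τ : C(stdSimplex ℝ (Fin 3), X)) :
    basisChain τ ≫ (singularChains X).d 2 1 = basisChain (τ.comp (edgeFace 0))
      - basisChain (τ.comp (edgeFace 1)) + basisChain (τ.comp (edgeFace 2)) := by
  have := SSet.ιChainComplex_d (TopCat.toSSet.obj (TopCat.of X)) (ModuleCat.of ℝ ℝ) (n := 1)
    (toSimplex τ)
  refine this.trans ?_
  rw [Fin.sum_univ_three]
  simp only [Fin.val_zero, Fin.val_one, Fin.val_two, pow_zero, pow_one, one_smul, neg_smul,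
    even_two, Even.neg_pow, one_pow]
  rw [← sub_eq_add_neg]
  rfl

/-- The singular `0`-simplex at `x`. -/
abbrev pointSimplex (x : X) : C(stdSimplex ℝ (Fin 1), X) := ContinuousMap.const _ x

theorem basisChain_d_one (σ : C(stdSimplex ℝ (Fin 2), X)) :
    basisChain σ ≫ (singularChains X).d 1 0 = basisChain (pointSimplex (σ (edgeVertex 1)))
      - basisChain (pointSimplex (σ (edgeVertex 0))) := by
  have := SSet.ιChainComplex_d (TopCat.toSSet.obj (TopCat.of X)) (ModuleCat.of ℝ ℝ) (n := 0)
    (toSimplex σ)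
  refine this.trans ?_
  rw [Fin.sum_univ_two]
  simp only [Fin.val_zero, Fin.val_one, pow_zero, pow_one, one_smul, neg_smul]
  rw [← sub_eq_add_neg]
  have key : ∀ i : Fin 2, σ.comp ⟨_, stdSimplex.continuous_map i.succAbove⟩ =
      pointSimplex (σ (edgeVertex (i.succAbove 0))) := by
    intro i
    ext s
    obtain rfl : s = stdSimplex.vertex 0 := Subsingleton.elim _ _
    exact congrArg σ (stdSimplex.map_vertex _ _)
  have e0 := key 0
  have e1 := key 1
  simp only [Fin.succAbove_zero, Fin.succ_zero_eq_one] at e0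
  change _ = pointSimplex (σ (edgeVertex 0)) at e1
  rw [← e0, ← e1]
  rfl

theorem d_evalChain (w : singularCocycles X) :
    (singularChains X).d 2 1 ≫ evalChain (n := 1) w.1 = 0 := by
  refine chain_hom_ext fun τ => ?_
  rw [← Category.assoc, basisChain_d_two, Preadditive.add_comp, Preadditive.sub_comp,
    basisChain_evalChain, basisChain_evalChain, basisChain_evalChain]
  ext
  have := w.2 τ
  simpa using this

/-- The functional on the first homology of the singular complex given by a cocycle. -/
def cocycleHom (w : singularCocycles X) : (singularChains X).homology 1 ⟶ ModuleCat.of ℝ ℝ :=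
  (singularChains X).homologyι 1 ≫
    (singularChains X).descOpcycles (evalChain (n := 1) w.1) 2 (by simp) (d_evalChain w)

/-- The functional on `H₁(X; ℝ)` given by a singular cocycle. -/
def cocyclePairing (w : singularCocycles X) : Module.Dual ℝ (H ℝ 1 X) :=
  (cocycleHom w).hom

theorem evalChain_add (w w' : C(stdSimplex ℝ (Fin 2), X) → ℝ) :
    evalChain (n := 1) (w + w') = evalChain w + evalChain w' := by
  refine chain_hom_ext fun τ => ?_
  rw [Preadditive.comp_add, basisChain_evalChain, basisChain_evalChain, basisChain_evalChain]
  ext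
  simp

theorem evalChain_smul (c : ℝ) (w : C(stdSimplex ℝ (Fin 2), X) → ℝ) :
    evalChain (n := 1) (c • w) = c • evalChain w := by
  refine chain_hom_ext fun τ => ?_
  rw [Linear.comp_smul, basisChain_evalChain, basisChain_evalChain]
  ext
  simp

theorem cocycleHom_add (w w' : singularCocycles X) :
    cocycleHom (w + w') = cocycleHom w + cocycleHom w' := by
  unfold cocycleHom
  rw [← Preadditive.comp_add]
  congr 1
  rw [← cancel_epi ((singularChains X).pOpcycles 1)]
  simp [evalChain_add]

theorem cocycleHom_smul (c : ℝ) (w : singularCocycles X) :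
    cocycleHom (c • w) = c • cocycleHom w := by
  unfold cocycleHom
  rw [← Linear.comp_smul]
  congr 1
  rw [← cancel_epi ((singularChains X).pOpcycles 1)]
  simp [evalChain_smul]

theorem cocyclePairing_add (w w' : singularCocycles X) :
    cocyclePairing (w + w') = cocyclePairing w + cocyclePairing w' :=
  congrArg ModuleCat.Hom.hom (cocycleHom_add w w')

theorem cocyclePairing_smul (c : ℝ) (w : singularCocycles X) :
    cocyclePairing (c • w) = c • cocyclePairing w :=
  congrArg ModuleCat.Hom.hom (cocycleHom_smul c w)

/-- The chain map induced by a continuous map. -/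
def singularChainsMap (f : C(X, Y)) : singularChains X ⟶ singularChains Y :=
  SSet.chainComplexMap (TopCat.toSSet.map (TopCat.ofHom f)) (ModuleCat.of ℝ ℝ)

theorem basisChain_map {n : ℕ} (f : C(X, Y)) (σ : C(stdSimplex ℝ (Fin (n + 1)), X)) :
    basisChain σ ≫ (singularChainsMap f).f n = basisChain (f.comp σ) :=
  SSet.ι_chainComplexMap_f _ _ (TopCat.toSSet.map (TopCat.ofHom f)) _ (toSimplex σ)

/-- The pullback of a singular cocycle along a continuous map. -/
def pullbackCocycle (f : C(X, Y)) (w : singularCocycles Y) : singularCocycles X :=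
  ⟨fun σ => w.1 (f.comp σ), fun τ => w.2 (f.comp τ)⟩

theorem cocycleHom_pullback (f : C(X, Y)) (w : singularCocycles Y) :
    cocycleHom (pullbackCocycle f w) =
      HomologicalComplex.homologyMap (singularChainsMap f) 1 ≫ cocycleHom w := by
  unfold cocycleHom
  rw [HomologicalComplex.homologyι_naturality_assoc,
    HomologicalComplex.opcyclesMap_comp_descOpcycles]
  congr 2
  refine chain_hom_ext fun σ => ?_
  rw [← Category.assoc, basisChain_map, basisChain_evalChain, basisChain_evalChain]
  rfl

theorem cocyclePairing_pullback (f : C(X, Y)) (w : singularCocycles Y) :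
    cocyclePairing (pullbackCocycle f w) = cocyclePairing w ∘ₗ Hmap ℝ 1 f :=
  congrArg ModuleCat.Hom.hom (cocycleHom_pullback f w)

theorem evalChain_surjective (k : (singularChains X).X 1 ⟶ ModuleCat.of ℝ ℝ) :
    ∃ w : C(stdSimplex ℝ (Fin 2), X) → ℝ, evalChain w = k := by
  refine ⟨fun σ => (basisChain σ ≫ k).hom (1 : ℝ), chain_hom_ext fun σ => ?_⟩
  rw [basisChain_evalChain]
  ext
  simp

theorem cocyclePairing_surjective (u : Module.Dual ℝ (H ℝ 1 X)) :
    ∃ w : singularCocycles X, cocyclePairing w = u := by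
  let u' : (singularChains X).homology 1 ⟶ ModuleCat.of ℝ ℝ := ModuleCat.ofHom u
  obtain ⟨k, hk, hu⟩ := exists_homologyι_descOpcycles_eq (singularChains X) u'
  obtain ⟨w, rfl⟩ := evalChain_surjective k
  refine ⟨⟨w, fun τ => ?_⟩, congrArg ModuleCat.Hom.hom hu⟩
  have h1 : basisChain τ ≫ (singularChains X).d 2 1 ≫ evalChain w = 0 := by
    rw [hk, Limits.comp_zero]
  rw [← Category.assoc, basisChain_d_two, Preadditive.add_comp, Preadditive.sub_comp,
    basisChain_evalChain, basisChain_evalChain, basisChain_evalChain] at h1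
  have h2 := LinearMap.congr_fun (congrArg ModuleCat.Hom.hom h1) (1 : ℝ)
  simpa using h2

/-- A cocycle pairs trivially with `H₁` if and only if it is a coboundary: as `ℝ` is a field, a
functional that vanishes on the cycles factors through the boundary map. -/
theorem cocyclePairing_eq_zero_iff (w : singularCocycles X) :
    cocyclePairing w = 0 ↔ ∃ m : X → ℝ, ∀ σ : C(stdSimplex ℝ (Fin 2), X),
      w.1 σ = m (σ (edgeVertex 1)) - m (σ (edgeVertex 0)) := by
  constructor
  · intro h
    have h0 : cocycleHom w = 0 := ModuleCat.hom_ext h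
    have h1 : (singularChains X).iCycles 1 ≫ evalChain (n := 1) w.1 = 0 := by
      have e : (singularChains X).homologyπ 1 ≫ cocycleHom w =
          (singularChains X).iCycles 1 ≫ evalChain (n := 1) w.1 := by
        unfold cocycleHom
        rw [HomologicalComplex.homology_π_ι_assoc, HomologicalComplex.p_descOpcycles]
      rw [← e, h0, Limits.comp_zero]
    obtain ⟨m, hm⟩ := exists_d_comp_eq _ _ h1
    refine ⟨fun x => (basisChain (pointSimplex x) ≫ m).hom (1 : ℝ), fun σ => ?_⟩
    have h5 : basisChain σ ≫ (singularChains X).d 1 0 ≫ m =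
        basisChain σ ≫ evalChain (n := 1) w.1 := by rw [hm]
    rw [← Category.assoc, basisChain_d_one, basisChain_evalChain, Preadditive.sub_comp] at h5
    have h6 := LinearMap.congr_fun (congrArg ModuleCat.Hom.hom h5) (1 : ℝ)
    simpa using h6.symm
  · rintro ⟨m, hm⟩
    have h : evalChain (n := 1) w.1 = (singularChains X).d 1 0 ≫
        evalChain (n := 0) fun σ => m (σ default) := by
      refine chain_hom_ext fun σ => ?_
      rw [← Category.assoc, basisChain_d_one, basisChain_evalChain, Preadditive.sub_comp,
        basisChain_evalChain, basisChain_evalChain, hm]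
      ext
      simp
    exact congrArg ModuleCat.Hom.hom
      (HomologicalComplex.homologyι_descOpcycles_eq_zero_of_boundary _ _ _ _ _ h)

/-- A singular `1`-cocycle on a contractible space is a coboundary. -/
theorem exists_potential_of_contractible [ContractibleSpace X] (w : singularCocycles X) :
    ∃ m : X → ℝ, ∀ σ : C(stdSimplex ℝ (Fin 2), X),
      w.1 σ = m (σ (edgeVertex 1)) - m (σ (edgeVertex 0)) := by
  rw [← cocyclePairing_eq_zero_iff]
  obtain ⟨x, hx⟩ := id_nullhomotopic X
  have h1 := cocyclePairing_pullback (ContinuousMap.id X) w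
  rw [Hmap_eq_of_homotopic ℝ 1 hx, ← cocyclePairing_pullback] at h1
  have h2 : pullbackCocycle (ContinuousMap.id X) w = w := rfl
  rw [← h2, h1]
  have h3 : pullbackCocycle (ContinuousMap.const X x) w = 0 := by
    ext σ
    have := w.2 (ContinuousMap.const _ x)
    simp only [ContinuousMap.const_comp, sub_self, zero_add] at this
    exact this
  rw [h3]
  simpa using cocyclePairing_smul (0 : ℝ) (0 : singularCocycles X)

/-! ### Germs of additive cocycles -/

section Germs
variable {X Y : Type*} [TopologicalSpace X] [TopologicalSpace Y]

/-- `D` satisfies the additive cocycle relation near `x`. A function `D : X → X → ℝ` that does so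
at every point is a locally constant `ℝ`-torsor with a chosen (discontinuous) section: only the
values `D x y` with `y` close to `x` matter, and they are the differences of a local potential. -/
def CocycleAt (D : X → X → ℝ) (x : X) : Prop :=
  ∀ᶠ y in 𝓝 x, ∀ᶠ z in 𝓝 y, D x z = D x y + D y z

/-- Near `x` the differences `D x y` are those of the potential `h`. -/
def PotentialAt (D : X → X → ℝ) (h : X → ℝ) (x : X) : Prop :=
  ∀ᶠ y in 𝓝 x, D x y = h y - h x

/-- `D` has a potential on some punctured neighbourhood of `x`, that is, `D` has no residue
at `x`. -/
def ResidueFree (D : X → X → ℝ) (x : X) : Prop :=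
  ∃ h : X → ℝ, ∀ᶠ y in 𝓝[≠] x, PotentialAt D h y

variable {D D' : X → X → ℝ} {h k : X → ℝ} {x : X}

theorem CocycleAt.self_eq_zero (hD : CocycleAt D x) : D x x = 0 := by
  have := hD.self_of_nhds.self_of_nhds
  linarith

theorem CocycleAt.add (hD : CocycleAt D x) (hD' : CocycleAt D' x) : CocycleAt (D + D') x := by
  filter_upwards [hD, hD'] with y h1 h2
  filter_upwards [h1, h2] with z h3 h4
  simp only [Pi.add_apply, h3, h4]
  ring

theorem CocycleAt.smul (c : ℝ) (hD : CocycleAt D x) : CocycleAt (c • D) x := by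
  filter_upwards [hD] with y h1
  filter_upwards [h1] with z h3
  simp only [Pi.smul_apply, h3, smul_eq_mul]
  ring

theorem CocycleAt.sub (hD : CocycleAt D x) (hD' : CocycleAt D' x) : CocycleAt (D - D') x := by
  have := hD.add (hD'.smul (-1))
  rwa [neg_one_smul, ← sub_eq_add_neg] at this

theorem CocycleAt.comp {f : Y → X} {b : Y} (hD : CocycleAt D (f b))
    (hf : ∀ᶠ c in 𝓝 b, ContinuousAt f c) : CocycleAt (fun c d => D (f c) (f d)) b := by
  filter_upwards [hf.self_of_nhds.eventually hD, hf] with y h1 h2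
  exact h2.eventually h1

theorem PotentialAt.add (hD : PotentialAt D h x) (hD' : PotentialAt D' k x) :
    PotentialAt (D + D') (h + k) x := by
  filter_upwards [hD, hD'] with y h1 h2
  simp only [Pi.add_apply, h1, h2]
  ring

theorem PotentialAt.smul (c : ℝ) (hD : PotentialAt D h x) : PotentialAt (c • D) (c • h) x := by
  filter_upwards [hD] with y h1
  simp only [Pi.smul_apply, h1, smul_eq_mul]
  ring

theorem PotentialAt.sub (hD : PotentialAt D h x) (hD' : PotentialAt D' k x) :
    PotentialAt (D - D') (h - k) x := by
  have := hD.add (hD'.smul (-1))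
  rwa [neg_one_smul, neg_one_smul, ← sub_eq_add_neg, ← sub_eq_add_neg] at this

theorem PotentialAt.comp {f : Y → X} {b : Y} (hD : PotentialAt D h (f b))
    (hf : ContinuousAt f b) : PotentialAt (fun c d => D (f c) (f d)) (h ∘ f) b :=
  hf.eventually hD

theorem PotentialAt.eventually_sub_eq (hD : PotentialAt D h x) (hD' : PotentialAt D k x) :
    ∀ᶠ y in 𝓝 x, h y - k y = h x - k x := by
  filter_upwards [hD, hD'] with y h1 h2
  linarith

theorem CocycleAt.of_potentialAt (hD : ∀ᶠ y in 𝓝 x, PotentialAt D h y) : CocycleAt D x := by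
  filter_upwards [hD, eventually_eventually_nhds.2 hD.self_of_nhds] with y h1 h2
  filter_upwards [h1, h2] with z h3 h4
  rw [h4, h3, h2.self_of_nhds]
  ring

theorem CocycleAt.of_sub (hD : CocycleAt D x) (hD' : ∀ᶠ y in 𝓝 x, PotentialAt (D' - D) h y) :
    CocycleAt D' x := by
  have := hD.add (CocycleAt.of_potentialAt hD')
  rwa [add_sub_cancel] at this

theorem ResidueFree.add (hD : ResidueFree D x) (hD' : ResidueFree D' x) :
    ResidueFree (D + D') x := by
  obtain ⟨h, hh⟩ := hD
  obtain ⟨k, hk⟩ := hD'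
  exact ⟨h + k, by filter_upwards [hh, hk] with y h1 h2 using h1.add h2⟩

theorem ResidueFree.smul (c : ℝ) (hD : ResidueFree D x) : ResidueFree (c • D) x := by
  obtain ⟨h, hh⟩ := hD
  exact ⟨c • h, by filter_upwards [hh] with y h1 using h1.smul c⟩

theorem ResidueFree.neg (hD : ResidueFree D x) : ResidueFree (-D) x := by
  have := hD.smul (-1)
  rwa [neg_one_smul] at this

theorem ResidueFree.sub (hD : ResidueFree D x) (hD' : ResidueFree D' x) :
    ResidueFree (D - D') x := by
  rw [sub_eq_add_neg]
  exact hD.add hD'.neg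

theorem ResidueFree.zero : ResidueFree (0 : X → X → ℝ) x :=
  ⟨0, Eventually.of_forall fun _ => Eventually.of_forall fun _ => by simp⟩

theorem ResidueFree.sum {ι : Type*} (s : Finset ι) {D : ι → X → X → ℝ}
    (hD : ∀ i ∈ s, ResidueFree (D i) x) : ResidueFree (∑ i ∈ s, D i) x := by
  classical
  induction s using Finset.induction_on with
  | empty => simpa using ResidueFree.zero
  | insert a s ha ih =>
    rw [Finset.sum_insert ha]
    exact (hD a (Finset.mem_insert_self a s)).add
      (ih fun i hi => hD i (Finset.mem_insert_of_mem hi))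

theorem CocycleAt.sum {ι : Type*} (s : Finset ι)
    {D : ι → X → X → ℝ} (hD : ∀ i ∈ s, CocycleAt (D i) x) : CocycleAt (∑ i ∈ s, D i) x := by
  classical
  induction s using Finset.induction_on with
  | empty => simp [CocycleAt]
  | insert a s ha ih =>
    rw [Finset.sum_insert ha]
    exact (hD a (Finset.mem_insert_self _ _)).add
      (ih fun i hi => hD i (Finset.mem_insert_of_mem hi))

theorem PotentialAt.sum {ι : Type*} (s : Finset ι)
    {D : ι → X → X → ℝ} {h : ι → X → ℝ} (hD : ∀ i ∈ s, PotentialAt (D i) (h i) x) :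
    PotentialAt (∑ i ∈ s, D i) (∑ i ∈ s, h i) x := by
  filter_upwards [(eventually_all_finset s).2 hD] with y hy
  simp only [Finset.sum_apply, ← Finset.sum_sub_distrib]
  exact Finset.sum_congr rfl hy

/-- Two potentials of the same germs on a preconnected set differ by a constant. -/
theorem potential_unique {s : Set X} (hs : IsPreconnected s)
    (hD : ∀ x ∈ s, ∀ᶠ y in 𝓝[s] x, h y - k y = h x - k x) {x y : X} (hx : x ∈ s) (hy : y ∈ s) :
    h x - k x = h y - k y := by
  have hc : ContinuousOn (fun z => (h z - k z)) s := fun z hz => by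
    refine tendsto_nhds_of_eventually_eq (hD z hz)
  have := isPreconnected_iff_preconnectedSpace.1 hs
  have hl : IsLocallyConstant (fun z : s => h z - k z) := by
    rw [IsLocallyConstant.iff_eventually_eq]
    intro z
    have := hD z z.2
    rwa [nhdsWithin_eq_map_subtype_coe z.2, eventually_map] at this
  exact hl.apply_eq_of_preconnectedSpace ⟨x, hx⟩ ⟨y, hy⟩

/-- A cocycle germ with no residue at `x` extends over `x`, after changing it by a coboundary. -/
theorem ResidueFree.exists_extension [T1Space X] (hD : ResidueFree D x) :
    ∃ (D' : X → X → ℝ) (k : X → ℝ), CocycleAt D' x ∧ ∀ y ≠ x, PotentialAt (D' - D) k y := by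
  classical
  obtain ⟨h, hh⟩ := hD
  refine ⟨fun y z => if y = x ∨ z = x then 0 else D y z - (h z - h y), -h, ?_, fun y hy => ?_⟩
  · rw [eventually_nhdsWithin_iff] at hh
    filter_upwards [hh] with y h1
    by_cases hy : y = x
    · simp [hy]
    · have h2 := h1 hy
      filter_upwards [h2] with z h3
      by_cases hz : z = x
      · simp [hz]
      · simp [hy, hz, h3]
  · filter_upwards [isOpen_compl_singleton.mem_nhds hy] with z hz
    have hz' : z ≠ x := hz
    simp only [Pi.sub_apply, hy, hz', or_self, if_false, Pi.neg_apply]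
    ring

end Germs

/-! ### Global potentials on simply connected spaces -/

/-- The real numbers with the discrete topology. -/
def DiscreteReal : Type := ℝ

/-- A point of `DiscreteReal` as a real number. -/
def DiscreteReal.val (v : DiscreteReal) : ℝ := v

instance : TopologicalSpace DiscreteReal := ⊥
instance : DiscreteTopology DiscreteReal := ⟨rfl⟩

section Covering
variable {X : Type*} [TopologicalSpace X]

/-- The torsor of local potentials of a cocycle, as a fibre bundle with discrete fibre. -/
def potentialBundle (D : X → X → ℝ) (hD : ∀ x, CocycleAt D x) :
    FiberBundleCore X X DiscreteReal where
  baseSet x := interior {y | ∀ᶠ z in 𝓝 y, D x z = D x y + D y z}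
  isOpen_baseSet _ := isOpen_interior
  indexAt x := x
  mem_baseSet_at x := mem_interior_iff_mem_nhds.2 (hD x)
  coordChange i j x v := v.val + D i x - D j x
  coordChange_self i x _ v := add_sub_cancel_right v.val (D i x)
  continuousOn_coordChange i j := by
    rintro ⟨y, v⟩ ⟨⟨hi, hj⟩, -⟩
    refine ContinuousAt.continuousWithinAt ?_
    refine tendsto_nhds_of_eventually_eq ?_
    rw [nhds_prod_eq, nhds_discrete DiscreteReal, prod_pure, eventually_map]
    have hi' : y ∈ {y | ∀ᶠ z in 𝓝 y, D i z = D i y + D y z} := interior_subset hi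
    have hj' : y ∈ {y | ∀ᶠ z in 𝓝 y, D j z = D j y + D y z} := interior_subset hj
    filter_upwards [hi', hj'] with z h1 h2
    change v.val + D i z - D j z = v.val + D i y - D j y
    rw [h1, h2]
    ring
  coordChange_comp i j k x _ v := by
    change v.val + D i x - D j x + D j x - D k x = v.val + D i x - D k x
    ring

/-- On a simply connected, locally path connected space every cocycle has a global potential. -/
theorem exists_potential [SimplyConnectedSpace X] [LocallyPathConnectedSpace X]
    (D : X → X → ℝ) (hD : ∀ x, CocycleAt D x) : ∃ h : X → ℝ, ∀ x, PotentialAt D h x := by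
  let Z := potentialBundle D hD
  have hcov : IsCoveringMap (Bundle.TotalSpace.proj : Z.TotalSpace → X) :=
    IsCoveringMap.mk _ (fun _ => DiscreteReal) (fun x => Z.localTrivAt x)
      fun x => Z.mem_localTrivAt_baseSet x
  obtain ⟨x₀⟩ : Nonempty X := inferInstance
  obtain ⟨F, ⟨-, hF⟩, -⟩ := hcov.existsUnique_continuousMap_lifts (ContinuousMap.id X) x₀
    (⟨x₀, (show DiscreteReal from (0 : ℝ))⟩ : Z.TotalSpace) rfl
  have hF' : ∀ y, (F y).1 = y := fun y => congrFun hF y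
  refine ⟨fun y => DiscreteReal.val (F y).2, fun x => ?_⟩
  have hc : ContinuousAt (fun y => ((Z.localTriv x) (F y)).2) x := by
    refine continuous_snd.continuousAt.comp (ContinuousAt.comp ?_ F.continuous.continuousAt)
    refine (Z.localTriv x).continuousAt ?_
    rw [Bundle.Trivialization.mem_source]
    change (F x).1 ∈ Z.baseSet x
    rw [hF' x]
    exact Z.mem_baseSet_at x
  have he := hc.eventually (show ∀ᶠ v in 𝓝 (((Z.localTriv x) (F x)).2),
      v = ((Z.localTriv x) (F x)).2 by rw [nhds_discrete]; rfl)
  have hval : ∀ y, DiscreteReal.val ((Z.localTriv x) (F y)).2 = DiscreteReal.val (F y).2 - D x y := by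
    intro y
    change DiscreteReal.val (F y).2 + D (F y).1 (F y).1 - D x (F y).1 = _
    rw [hF' y, (hD y).self_eq_zero, add_zero]
  filter_upwards [he] with y hy
  have h1 := congrArg DiscreteReal.val hy
  rw [hval, hval, (hD x).self_eq_zero] at h1
  change D x y = DiscreteReal.val (F y).2 - DiscreteReal.val (F x).2
  linarith

end Covering

theorem convex_locallyPathConnectedSpace {E : Type*} [NormedAddCommGroup E] [NormedSpace ℝ E]
    {s : Set E} (hs : Convex ℝ s) : LocallyPathConnectedSpace s := by
  refine LocallyPathConnectedSpace.of_bases (p := fun _ r => 0 < r)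
    (s := fun x r => Metric.ball x r) (fun x => Metric.nhds_basis_ball) fun x r hr => ?_
  have : Metric.ball x r = Subtype.val ⁻¹' (Metric.ball (x : E) r) := rfl
  rw [this, Topology.IsInducing.subtypeVal.isPathConnected_iff, Subtype.image_preimage_coe]
  exact (hs.inter (convex_ball _ _)).isPathConnected ⟨x, x.2, Metric.mem_ball_self hr⟩

instance (n : ℕ) : LocallyPathConnectedSpace (stdSimplex ℝ (Fin (n + 1))) :=
  convex_locallyPathConnectedSpace (convex_stdSimplex ℝ _)

instance (n : ℕ) : ContractibleSpace (stdSimplex ℝ (Fin (n + 1))) :=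
  (convex_stdSimplex ℝ _).contractibleSpace ⟨_, (stdSimplex.vertex 0).2⟩

/-! ### Periods of cocycle germs -/

section Periods
variable {X Y : Type} [TopologicalSpace X] [TopologicalSpace Y]

/-- The functional `u` on `H₁(X; ℝ)` is integration of the cocycle germs `D`: on a singular edge
`σ` it is represented by the increment of a potential of `D` along `σ`. -/
def IsPeriod (D : X → X → ℝ) (u : Module.Dual ℝ (H ℝ 1 X)) : Prop :=
  ∃ w : singularCocycles X, cocyclePairing w = u ∧ ∀ σ : C(stdSimplex ℝ (Fin 2), X),
    ∃ h : stdSimplex ℝ (Fin 2) → ℝ, (∀ s, PotentialAt (fun a b => D (σ a) (σ b)) h s) ∧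
      w.1 σ = h (edgeVertex 1) - h (edgeVertex 0)

variable {D D' : X → X → ℝ} {u u' : Module.Dual ℝ (H ℝ 1 X)}

theorem potential_increment_unique {Z : Type*} [TopologicalSpace Z] [PreconnectedSpace Z]
    {E : Z → Z → ℝ} {h k : Z → ℝ} (hh : ∀ s, PotentialAt E h s) (hk : ∀ s, PotentialAt E k s)
    (a b : Z) : h b - h a = k b - k a := by
  have := potential_unique (h := h) (k := k) (isPreconnected_univ (α := Z))
    (fun s _ => by rw [nhdsWithin_univ]; exact (hh s).eventually_sub_eq (hk s))
    (Set.mem_univ a) (Set.mem_univ b)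
  linarith

theorem exists_isPeriod (hD : ∀ x, CocycleAt D x) : ∃ u, IsPeriod D u := by
  have hc : ∀ {n : ℕ} (σ : C(stdSimplex ℝ (Fin (n + 1)), X)), ∃ h : stdSimplex ℝ (Fin (n + 1)) → ℝ,
      ∀ s, PotentialAt (fun a b => D (σ a) (σ b)) h s := fun σ =>
    exists_potential _ fun s => (hD (σ s)).comp (.of_forall fun _ => σ.continuous.continuousAt)
  choose h hh using fun σ : C(stdSimplex ℝ (Fin 2), X) => hc σ
  refine ⟨cocyclePairing ⟨fun σ => h σ (edgeVertex 1) - h σ (edgeVertex 0), fun τ => ?_⟩,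
    _, rfl, fun σ => ⟨h σ, hh σ, rfl⟩⟩
  obtain ⟨k, hk⟩ := hc τ
  have key : ∀ i : Fin 3, h (τ.comp (edgeFace i)) (edgeVertex 1) -
      h (τ.comp (edgeFace i)) (edgeVertex 0) =
      k (stdSimplex.vertex (i.succAbove 1)) - k (stdSimplex.vertex (i.succAbove 0)) := by
    intro i
    have := potential_increment_unique (hh (τ.comp (edgeFace i)))
      (fun s => (hk (edgeFace i s)).comp (edgeFace i).continuous.continuousAt)
      (edgeVertex 0) (edgeVertex 1)
    rw [this]
    simp only [Function.comp_apply]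
    congr 2 <;> exact stdSimplex.map_vertex _ _
  have e0 := key 0
  have e1 := key 1
  have e2 := key 2
  simp only [show (0 : Fin 3).succAbove 1 = 2 from rfl, show (0 : Fin 3).succAbove 0 = 1 from rfl,
    show (1 : Fin 3).succAbove 1 = 2 from rfl, show (1 : Fin 3).succAbove 0 = 0 from rfl,
    show (2 : Fin 3).succAbove 1 = 1 from rfl, show (2 : Fin 3).succAbove 0 = 0 from rfl] at e0 e1 e2
  linarith

theorem IsPeriod.add (hu : IsPeriod D u) (hu' : IsPeriod D' u') : IsPeriod (D + D') (u + u') := by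
  obtain ⟨w, rfl, hw⟩ := hu
  obtain ⟨w', rfl, hw'⟩ := hu'
  refine ⟨w + w', cocyclePairing_add w w', fun σ => ?_⟩
  obtain ⟨h, hh, h1⟩ := hw σ
  obtain ⟨k, hk, h2⟩ := hw' σ
  refine ⟨h + k, fun s => (hh s).add (hk s), ?_⟩
  simp only [Submodule.coe_add, Pi.add_apply, h1, h2]
  ring

theorem IsPeriod.smul (c : ℝ) (hu : IsPeriod D u) : IsPeriod (c • D) (c • u) := by
  obtain ⟨w, rfl, hw⟩ := hu
  refine ⟨c • w, cocyclePairing_smul c w, fun σ => ?_⟩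
  obtain ⟨h, hh, h1⟩ := hw σ
  refine ⟨c • h, fun s => (hh s).smul c, ?_⟩
  simp only [Submodule.coe_smul, Pi.smul_apply, h1, smul_eq_mul]
  ring

theorem IsPeriod.sub (hu : IsPeriod D u) (hu' : IsPeriod D' u') :
    IsPeriod (D - D') (u - u') := by
  have := hu.add (hu'.smul (-1))
  have e1 : D + (-1 : ℝ) • D' = D - D' := by rw [neg_one_smul, sub_eq_add_neg]
  have e2 : u + (-1 : ℝ) • u' = u - u' := by module
  rwa [e1, e2] at this

theorem IsPeriod.comp (f : C(Y, X)) (hu : IsPeriod D u) :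
    IsPeriod (fun a b => D (f a) (f b)) (u ∘ₗ Hmap ℝ 1 f) := by
  obtain ⟨w, rfl, hw⟩ := hu
  exact ⟨pullbackCocycle f w, cocyclePairing_pullback f w, fun σ => hw (f.comp σ)⟩

theorem IsPeriod.eq_zero (hu : IsPeriod D u) {h : X → ℝ} (hD : ∀ x, PotentialAt D h x) :
    u = 0 := by
  obtain ⟨w, rfl, hw⟩ := hu
  rw [cocyclePairing_eq_zero_iff]
  refine ⟨h, fun σ => ?_⟩
  obtain ⟨k, hk, h1⟩ := hw σ
  rw [h1]
  exact potential_increment_unique hk (fun s => (hD (σ s)).comp σ.continuous.continuousAt) _ _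

theorem isPeriod_zero : IsPeriod (0 : X → X → ℝ) 0 := by
  obtain ⟨u, hu⟩ := exists_isPeriod (D := (0 : X → X → ℝ)) fun x => by simp [CocycleAt]
  have := hu.smul 0
  simpa using this

theorem IsPeriod.sum {ι : Type*} (s : Finset ι) {D : ι → X → X → ℝ}
    {u : ι → Module.Dual ℝ (H ℝ 1 X)} (hu : ∀ i ∈ s, IsPeriod (D i) (u i)) :
    IsPeriod (∑ i ∈ s, D i) (∑ i ∈ s, u i) := by
  classical
  induction s using Finset.induction_on with
  | empty => simpa using isPeriod_zero
  | insert a s ha ih =>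
    rw [Finset.sum_insert ha, Finset.sum_insert ha]
    exact (hu a (Finset.mem_insert_self a s)).add
      (ih fun i hi => hu i (Finset.mem_insert_of_mem hi))

/-- A path as a singular edge. -/
def edgeOfPath {x y : X} (γ : Path x y) : C(stdSimplex ℝ (Fin 2), X) :=
  γ.toContinuousMap.comp ⟨stdSimplexHomeomorphUnitInterval,
    stdSimplexHomeomorphUnitInterval.continuous⟩

theorem edgeOfPath_zero {x y : X} (γ : Path x y) : edgeOfPath γ (edgeVertex 0) = x := by
  have : stdSimplexHomeomorphUnitInterval (edgeVertex 0) = 0 := by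
    exact stdSimplexHomeomorphUnitInterval_zero
  change γ (stdSimplexHomeomorphUnitInterval (edgeVertex 0)) = x
  rw [this, γ.source]

theorem edgeOfPath_one {x y : X} (γ : Path x y) : edgeOfPath γ (edgeVertex 1) = y := by
  have : stdSimplexHomeomorphUnitInterval (edgeVertex 1) = 1 := by
    exact stdSimplexHomeomorphUnitInterval_one
  change γ (stdSimplexHomeomorphUnitInterval (edgeVertex 1)) = y
  rw [this, γ.target]

/-- Cocycle germs all of whose periods vanish have a global potential. -/
theorem IsPeriod.exists_potential [LocallyPathConnectedSpace X] (hD : ∀ x, CocycleAt D x)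
    (hu : IsPeriod D 0) : ∃ h : X → ℝ, ∀ x, PotentialAt D h x := by
  obtain ⟨w, hw0, hw⟩ := hu
  obtain ⟨m, hm⟩ := (cocyclePairing_eq_zero_iff w).1 hw0
  refine ⟨m, fun x => ?_⟩
  obtain ⟨N, ⟨hN, hNc⟩, hNs⟩ := (LocallyPathConnectedSpace.path_connected_basis x).mem_iff.1 (hD x)
  filter_upwards [hN] with y hy
  obtain ⟨γ, hγ⟩ := hNc.joinedIn x (mem_of_mem_nhds hN) y hy
  obtain ⟨k, hk, h1⟩ := hw (edgeOfPath γ)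
  have h2 : ∀ s, PotentialAt (fun a b => D (edgeOfPath γ a) (edgeOfPath γ b))
      (fun s => D x (edgeOfPath γ s)) s := by
    intro s
    have h3 : ∀ᶠ z in 𝓝 (edgeOfPath γ s), D x z = D x (edgeOfPath γ s) + D (edgeOfPath γ s) z :=
      hNs (hγ _)
    filter_upwards [(edgeOfPath γ).continuous.continuousAt.eventually h3] with t ht
    simp only [ht]
    ring
  have h4 := potential_increment_unique hk h2 (edgeVertex 0) (edgeVertex 1)
  rw [← h1, hm] at h4
  simp only [edgeOfPath_zero, edgeOfPath_one, (hD x).self_eq_zero, sub_zero] at h4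
  exact h4.symm

/-- The affine map from one standard simplex to another with given values at the vertices. -/
def affineSimplex {n m : ℕ} (v : Fin (n + 1) → stdSimplex ℝ (Fin m)) :
    C(stdSimplex ℝ (Fin (n + 1)), stdSimplex ℝ (Fin m)) where
  toFun s := ⟨∑ i, s i • (v i : Fin m → ℝ), (convex_stdSimplex ℝ (Fin m)).sum_mem
    (fun i _ => s.2.1 i) s.2.2 fun i _ => (v i).2⟩
  continuous_toFun := by
    refine Continuous.subtype_mk (continuous_finsetSum _ fun i _ => ?_) _
    exact ((continuous_apply i).comp continuous_subtype_val).smul continuous_const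

theorem affineSimplex_vertex {n m : ℕ} (v : Fin (n + 1) → stdSimplex ℝ (Fin m)) (i : Fin (n + 1)) :
    affineSimplex v (stdSimplex.vertex i) = v i := by
  apply Subtype.ext
  change ∑ j, (stdSimplex.vertex (S := ℝ) i : Fin (n + 1) → ℝ) j • (v j : Fin m → ℝ) = v i
  rw [stdSimplex.vertex_coe]
  simp [Pi.single_apply, ite_smul]

theorem affineSimplex_face {m : ℕ} (v : Fin 3 → stdSimplex ℝ (Fin m)) (i : Fin 3) :
    (affineSimplex v).comp (edgeFace i) = affineSimplex (v ∘ i.succAbove) := by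
  refine ContinuousMap.ext fun s => Subtype.ext ?_
  change ∑ j, (stdSimplex.map i.succAbove s : Fin 3 → ℝ) j • (v j : Fin m → ℝ) =
    ∑ j, s j • (v (i.succAbove j) : Fin m → ℝ)
  rw [stdSimplex.map_coe, Fin.sum_univ_succAbove _ i]
  simp only [FunOnFinite.linearMap_apply_apply]
  simp [Fin.succAbove_ne, Finset.filter_eq']

theorem affineSimplex_edge : affineSimplex ![edgeVertex 0, edgeVertex 1] = ContinuousMap.id _ := by
  refine ContinuousMap.ext fun s => Subtype.ext ?_
  change ∑ j, s j • ((![edgeVertex 0, edgeVertex 1] : Fin 2 → stdSimplex ℝ (Fin 2)) j :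
    Fin 2 → ℝ) = s
  rw [Fin.sum_univ_two]
  simp only [Matrix.cons_val_zero, Matrix.cons_val_one, edgeVertex, stdSimplex.vertex_coe]
  ext i
  fin_cases i <;> simp

theorem continuous_affineSimplex_edge {m : ℕ} (t : stdSimplex ℝ (Fin m)) :
    Continuous fun q : stdSimplex ℝ (Fin m) × stdSimplex ℝ (Fin 2) =>
      affineSimplex ![t, q.1] q.2 := by
  have h : Continuous fun q : stdSimplex ℝ (Fin m) × stdSimplex ℝ (Fin 2) =>
      ∑ j, q.2 j • ((![t, q.1] : Fin 2 → stdSimplex ℝ (Fin m)) j : Fin m → ℝ) := ?_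
  · exact h.subtype_mk _
  simp only [Fin.sum_univ_two, Matrix.cons_val_zero, Matrix.cons_val_one]
  have hr : ∀ i, Continuous fun q : stdSimplex ℝ (Fin m) × stdSimplex ℝ (Fin 2) => q.2 i :=
    fun i => (continuous_apply i).comp (continuous_subtype_val.comp continuous_snd)
  have hq : Continuous fun q : stdSimplex ℝ (Fin m) × stdSimplex ℝ (Fin 2) =>
      (q.1 : Fin m → ℝ) := continuous_subtype_val.comp continuous_fst
  exact ((hr 0).smul continuous_const).add ((hr 1).smul hq)

theorem affineSimplex_const {m : ℕ} (t : stdSimplex ℝ (Fin m)) (r : stdSimplex ℝ (Fin 2)) :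
    affineSimplex ![t, t] r = t := by
  apply Subtype.ext
  change ∑ j, r j • ((![t, t] : Fin 2 → stdSimplex ℝ (Fin m)) j : Fin m → ℝ) = t
  have : r 0 + r 1 = 1 := stdSimplex.add_eq_one r
  simp [Fin.sum_univ_two, ← add_smul, this]

theorem singularCocycle_affine (w : singularCocycles X) {m : ℕ} (σ : C(stdSimplex ℝ (Fin m), X))
    (a b c : stdSimplex ℝ (Fin m)) :
    w.1 (σ.comp (affineSimplex ![a, c])) =
      w.1 (σ.comp (affineSimplex ![a, b])) + w.1 (σ.comp (affineSimplex ![b, c])) := by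
  have h := w.2 (σ.comp (affineSimplex ![a, b, c]))
  have e0 : (![a, b, c] : Fin 3 → stdSimplex ℝ (Fin m)) ∘ (0 : Fin 3).succAbove = ![b, c] := by
    ext i : 1; fin_cases i <;> rfl
  have e1 : (![a, b, c] : Fin 3 → stdSimplex ℝ (Fin m)) ∘ (1 : Fin 3).succAbove = ![a, c] := by
    ext i : 1; fin_cases i <;> rfl
  have e2 : (![a, b, c] : Fin 3 → stdSimplex ℝ (Fin m)) ∘ (2 : Fin 3).succAbove = ![a, b] := by
    ext i : 1; fin_cases i <;> rfl
  simp only [ContinuousMap.comp_assoc, affineSimplex_face, e0, e1, e2] at h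
  linarith

theorem exists_local_potential {U : Set X} [ContractibleSpace U] (w : singularCocycles X) :
    ∃ k : X → ℝ, ∀ σ : C(stdSimplex ℝ (Fin 2), X), (∀ s, σ s ∈ U) →
      w.1 σ = k (σ (edgeVertex 1)) - k (σ (edgeVertex 0)) := by
  classical
  obtain ⟨m, hm⟩ := exists_potential_of_contractible
    (pullbackCocycle ⟨(Subtype.val : U → X), continuous_subtype_val⟩ w)
  refine ⟨fun x => if h : x ∈ U then m ⟨x, h⟩ else 0, fun σ hσ => ?_⟩
  have := hm ⟨fun s => ⟨σ s, hσ s⟩, σ.continuous.subtype_mk _⟩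
  simp only [hσ, dif_pos]
  exact this

/-- On a space with contractible neighbourhoods every functional on `H₁` is given by integration
of cocycle germs. -/
theorem exists_cocycle_isPeriod [LocallyPathConnectedSpace X]
    (hX : ∀ x : X, ∃ U ∈ 𝓝 x, ContractibleSpace U) (u : Module.Dual ℝ (H ℝ 1 X)) :
    ∃ D : X → X → ℝ, (∀ x, CocycleAt D x) ∧ IsPeriod D u := by
  obtain ⟨w, rfl⟩ := cocyclePairing_surjective u
  choose U hU hUc using hX
  choose k hk using fun x => exists_local_potential (U := U x) w
  have hD : ∀ x y z, ∀ N ⊆ U x ∩ U y, IsPathConnected N → y ∈ N → z ∈ N →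
      k x z - k x y = k y z - k y y := by
    intro x y z N hNU hN hy hz
    obtain ⟨γ, hγ⟩ := hN.joinedIn y hy z hz
    have h1 := hk x (edgeOfPath γ) fun s => (hNU (hγ _)).1
    have h2 := hk y (edgeOfPath γ) fun s => (hNU (hγ _)).2
    rw [edgeOfPath_zero, edgeOfPath_one] at h1 h2
    linarith
  -- `D x y` is the value of the singular cocycle on any short path from `x` to `y`.
  refine ⟨fun x y => k x y - k x x, fun x => ?_, w, rfl, fun σ => ?_⟩
  · filter_upwards [eventually_mem_nhds_iff.2 (hU x)] with y hy
    obtain ⟨N, ⟨hN, hNc⟩, hNs⟩ := (LocallyPathConnectedSpace.path_connected_basis y).mem_iff.1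
      (inter_mem hy (hU y))
    filter_upwards [hN] with z hz
    have := hD x y z N hNs hNc (mem_of_mem_nhds hN) hz
    linarith
  -- Along `σ` the values of the singular cocycle on the initial segments of `σ` are a potential.
  · refine ⟨fun t => w.1 (σ.comp (affineSimplex ![edgeVertex 0, t])), fun t => ?_, ?_⟩
    · have hnear : ∀ᶠ s in 𝓝 t, ∀ r ∈ (Set.univ : Set (stdSimplex ℝ (Fin 2))),
          σ (affineSimplex ![t, s] r) ∈ U (σ t) := by
        refine isCompact_univ.eventually_forall_of_forall_eventually
          (P := fun s r => σ (affineSimplex ![t, s] r) ∈ U (σ t)) fun r _ => ?_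
        have hc : ContinuousAt (fun q : stdSimplex ℝ (Fin 2) × stdSimplex ℝ (Fin 2) =>
            σ (affineSimplex ![t, q.1] q.2)) (t, r) :=
          (σ.continuous.comp (continuous_affineSimplex_edge t)).continuousAt
        refine hc.eventually ?_
        change U (σ t) ∈ 𝓝 (σ (affineSimplex ![t, t] r))
        rw [affineSimplex_const]
        exact hU (σ t)
      filter_upwards [hnear] with s hs
      have h1 := hk (σ t) (σ.comp (affineSimplex ![t, s])) fun r => hs r (Set.mem_univ r)
      have h2 := singularCocycle_affine w σ (edgeVertex 0) t s
      have e0 : affineSimplex ![t, s] (edgeVertex 0) = t := affineSimplex_vertex _ _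
      have e1 : affineSimplex ![t, s] (edgeVertex 1) = s := affineSimplex_vertex _ _
      simp only [ContinuousMap.comp_apply, e0, e1] at h1
      linarith
    · have h0 := singularCocycle_affine w σ (edgeVertex 0) (edgeVertex 0) (edgeVertex 0)
      simp only [affineSimplex_edge, ContinuousMap.comp_id]
      linarith

end Periods

/-! ### The argument cocycle -/

/-- The angle cocycle of a complex function: its potentials are the continuous branches of the
argument of `g`. -/
def argCocycle {X : Type*} (g : X → ℂ) : X → X → ℝ := fun y z => Complex.arg (g z / g y)

theorem arg_mul_of_re_pos {a b : ℂ} (ha : 0 < a.re) (hb : 0 < b.re) :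
    Complex.arg (a * b) = Complex.arg a + Complex.arg b := by
  have h1 := abs_lt.1 (Complex.abs_arg_lt_pi_div_two_iff.2 (Or.inl ha))
  have h2 := abs_lt.1 (Complex.abs_arg_lt_pi_div_two_iff.2 (Or.inl hb))
  have ha0 : a ≠ 0 := fun h => by simp [h] at ha
  have hb0 : b ≠ 0 := fun h => by simp [h] at hb
  exact Complex.arg_mul ha0 hb0 ⟨by linarith [h1.1, h2.1], by linarith [h1.2, h2.2]⟩

theorem arg_inv_of_re_pos {a : ℂ} (ha : 0 < a.re) : Complex.arg a⁻¹ = - Complex.arg a := by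
  have h1 := abs_lt.1 (Complex.abs_arg_lt_pi_div_two_iff.2 (Or.inl ha))
  rw [Complex.arg_inv, if_neg]
  have := Real.pi_pos
  linarith [h1.2]

theorem inv_re_pos {a : ℂ} (ha : 0 < a.re) : 0 < (a⁻¹).re := by
  rw [Complex.inv_re]
  refine div_pos ha (Complex.normSq_pos.2 ?_)
  rintro rfl
  simp at ha

section ArgCocycle
variable {X : Type*} [TopologicalSpace X] {g g' : X → ℂ} {x : X}

theorem eventually_re_div_pos (hg : ContinuousAt g x) (h0 : g x ≠ 0) :
    ∀ᶠ y in 𝓝 x, 0 < (g y / g x).re := by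
  have h : ContinuousAt (fun y => (g y / g x).re) x :=
    Complex.continuous_re.continuousAt.comp (hg.div_const _)
  refine h.eventually (lt_mem_nhds ?_)
  simp [div_self h0]

theorem cocycleAt_argCocycle (hg : ∀ᶠ y in 𝓝 x, ContinuousAt g y) (h0 : g x ≠ 0) :
    CocycleAt (argCocycle g) x := by
  filter_upwards [hg, eventually_re_div_pos hg.self_of_nhds h0,
    hg.self_of_nhds.eventually_ne h0] with y h1 h2 h3
  filter_upwards [eventually_re_div_pos h1 h3] with z h4
  have e : g z / g x = (g y / g x) * (g z / g y) := by field_simp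
  unfold argCocycle
  rw [e, arg_mul_of_re_pos h2 h4]

theorem potentialAt_argCocycle_div (hg : ContinuousAt g x) (hg' : ContinuousAt g' x)
    (h0 : g x ≠ 0) (h0' : g' x ≠ 0) :
    PotentialAt (argCocycle (g / g') - (argCocycle g - argCocycle g')) 0 x := by
  filter_upwards [eventually_re_div_pos hg h0, eventually_re_div_pos hg' h0',
    hg'.eventually_ne h0'] with y h1 h2 h3
  have e : (g / g') y / (g / g') x = (g y / g x) * (g' y / g' x)⁻¹ := by
    simp only [Pi.div_apply]
    field_simp
  simp only [argCocycle, Pi.sub_apply, e, arg_mul_of_re_pos h1 (inv_re_pos h2),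
    arg_inv_of_re_pos h2, Pi.zero_apply]
  ring

theorem potentialAt_argCocycle_of_re_pos (hg : ContinuousAt g x) (h0 : 0 < (g x).re) :
    PotentialAt (argCocycle g) (fun y => Complex.arg (g y)) x := by
  have h : ContinuousAt (fun y => (g y).re) x := Complex.continuous_re.continuousAt.comp hg
  filter_upwards [h.eventually (lt_mem_nhds h0)] with y h1
  unfold argCocycle
  rw [div_eq_mul_inv, arg_mul_of_re_pos h1 (inv_re_pos h0), arg_inv_of_re_pos h0, ← sub_eq_add_neg]

end ArgCocycle

theorem eventually_arg_exp_div (u : ℂ) :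
    ∀ᶠ v in 𝓝 u, Complex.arg (Complex.exp v / Complex.exp u) = v.im - u.im := by
  have h : ContinuousAt (fun v : ℂ => (v - u).im) u := by fun_prop
  have h1 : ∀ᶠ v in 𝓝 u, (v - u).im ∈ Set.Ioo (-Real.pi) Real.pi :=
    h.eventually (Ioo_mem_nhds (by simp [Real.pi_pos]) (by simp [Real.pi_pos]))
  filter_upwards [h1] with v hv
  rw [← Complex.exp_sub, ← Complex.log_im, Complex.log_exp hv.1 hv.2.le, Complex.sub_im]

/-- On the punctured plane every cocycle is a multiple of the angle, up to a potential. The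
multiple is the monodromy of a potential of the pullback along the exponential. -/
theorem exists_residue_punctured_plane {D : ℂ → ℂ → ℝ} (hD : ∀ y ≠ 0, CocycleAt D y) :
    ∃ (c : ℝ) (h : ℂ → ℝ), ∀ y ≠ 0, PotentialAt (D - c • argCocycle id) h y := by
  obtain ⟨l, hl⟩ := exists_potential (fun a b => D (Complex.exp a) (Complex.exp b)) fun u =>
    (hD _ (Complex.exp_ne_zero u)).comp (.of_forall fun _ => Complex.continuous_exp.continuousAt)
  have hshift : ∀ u, l (u + 2 * Real.pi * Complex.I) - l u = l (2 * Real.pi * Complex.I) - l 0 := by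
    intro u
    have h2 : ∀ u, PotentialAt (fun a b => D (Complex.exp a) (Complex.exp b))
        (fun u => l (u + 2 * Real.pi * Complex.I)) u := by
      intro u
      have := (hl (u + 2 * Real.pi * Complex.I)).comp
        (f := fun u => u + 2 * Real.pi * Complex.I) (by fun_prop)
      simpa only [Complex.exp_periodic _, Function.comp_def] using this
    have h3 := potential_increment_unique hl h2 0 u
    simp only [zero_add] at h3
    linarith
  set c : ℝ := (l (2 * Real.pi * Complex.I) - l 0) / (2 * Real.pi) with hc
  have hper : Function.Periodic (fun u : ℂ => l u - c * u.im) (2 * Real.pi * Complex.I) := by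
    intro u
    have h1 := hshift u
    have h2 : c * (2 * Real.pi) = l (2 * Real.pi * Complex.I) - l 0 := by
      rw [hc]
      field_simp
    have h3 : (u + 2 * Real.pi * Complex.I).im = u.im + 2 * Real.pi := by simp
    simp only [h3]
    linarith
  refine ⟨c, fun y => l (Complex.log y) - c * (Complex.log y).im, fun y hy => ?_⟩
  have hexp : ∀ u : ℂ, l (Complex.log (Complex.exp u)) - c * (Complex.log (Complex.exp u)).im =
      l u - c * u.im := by
    intro u
    obtain ⟨n, hn⟩ := Complex.exp_eq_exp_iff_exists_int.1
      (Complex.exp_log (Complex.exp_ne_zero u))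
    rw [hn]
    exact hper.int_mul n u
  obtain ⟨u, rfl⟩ : ∃ u, Complex.exp u = y := ⟨_, Complex.exp_log hy⟩
  refine Complex.isOpenMap_exp.nhds_le u ?_
  rw [mem_map]
  filter_upwards [hl u, eventually_arg_exp_div u] with v h1 h2
  simp only [Set.mem_preimage, Set.mem_ofPred_eq, hexp]
  simp only [Pi.sub_apply, Pi.smul_apply, argCocycle, id, smul_eq_mul, h1, h2]
  ring

/-- The angle has no potential around a circle. -/
theorem eq_zero_of_potentialAt_circle {c r : ℝ} (hr : 0 < r) {k : ℂ → ℝ}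
    (hk : ∀ y : ℂ, ‖y‖ = r → PotentialAt (c • argCocycle id) k y) : c = 0 := by
  let e : ℝ → ℂ := fun s => Complex.exp ((Real.log r : ℂ) + s * Complex.I)
  have he : Continuous e := by fun_prop
  have hn : ∀ s, ‖e s‖ = r := fun s => by
    simp [e, Complex.norm_exp, Real.exp_log hr]
  have h1 : ∀ s, PotentialAt (fun a b => (c • argCocycle id) (e a) (e b)) (k ∘ e) s := fun s =>
    (hk _ (hn s)).comp he.continuousAt
  have h2 : ∀ s, PotentialAt (fun a b => (c • argCocycle id) (e a) (e b)) (fun s => c * s) s := by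
    intro s
    have h3 : ContinuousAt (fun t : ℝ => (Real.log r : ℂ) + t * Complex.I) s := by fun_prop
    filter_upwards [h3.eventually (eventually_arg_exp_div _)] with t ht
    simp only [Pi.smul_apply, argCocycle, id, e, smul_eq_mul, ht]
    simp
    ring
  have h3 := potential_increment_unique h1 h2 0 (2 * Real.pi)
  have h4 : e (2 * Real.pi) = e 0 := by
    simp [e, Complex.exp_add, Complex.exp_two_pi_mul_I]
  simp only [Function.comp_apply, h4, sub_self, mul_zero, sub_zero] at h3
  have := Real.pi_pos
  rcases mul_eq_zero.1 h3.symm with h | h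
  · exact h
  · linarith

/-! ### Residues in disc charts -/

section Charts
variable {X : Type*} [TopologicalSpace X]

/-- `ψ` is a chart onto the whole plane centred at `x`. -/
structure IsDiscChart (ψ : OpenPartialHomeomorph X ℂ) (x : X) : Prop where
  mem_source : x ∈ ψ.source
  apply_center : ψ x = 0
  target_eq : ψ.target = Set.univ

variable {ψ : OpenPartialHomeomorph X ℂ} {x : X}

theorem univBall_apply_eq {r : ℝ} (hr : 0 < r) (z : ℂ) :
    OpenPartialHomeomorph.univBall (0 : ℂ) r z = ((r * (√(1 + ‖z‖ ^ 2))⁻¹ : ℝ) : ℂ) * z := by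
  unfold OpenPartialHomeomorph.univBall
  rw [dif_pos hr]
  change r • OpenPartialHomeomorph.univUnitBall z + 0 = _
  rw [OpenPartialHomeomorph.univUnitBall_apply, add_zero, smul_smul, Complex.real_smul]

/-- A centred chart can be shrunk radially to a disc chart inside a given neighbourhood, and this
does not change its angle cocycle. -/
theorem exists_discChart_subset {φ : OpenPartialHomeomorph X ℂ} (hx : x ∈ φ.source)
    (h0 : φ x = 0) {U : Set X} (hU : U ∈ 𝓝 x) :
    ∃ ψ : OpenPartialHomeomorph X ℂ, IsDiscChart ψ x ∧ ψ.source ⊆ U ∩ φ.source ∧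
      ∀ y ∈ ψ.source, ∀ z ∈ ψ.source, argCocycle ψ y z = argCocycle φ y z := by
  have hV : φ.target ∩ φ.symm ⁻¹' U ∈ 𝓝 (0 : ℂ) := by
    rw [← h0]
    refine inter_mem (φ.open_target.mem_nhds (φ.map_source hx)) ?_
    refine (φ.symm.continuousAt (φ.map_source hx)).preimage_mem_nhds ?_
    rwa [φ.left_inv hx]
  obtain ⟨r, hr, hrV⟩ := Metric.mem_nhds_iff.1 hV
  let B := OpenPartialHomeomorph.univBall (0 : ℂ) r
  have hBs : B.source = Set.univ := OpenPartialHomeomorph.univBall_source _ _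
  have hBt : B.target = Metric.ball 0 r := OpenPartialHomeomorph.univBall_target _ hr
  have hsrc : ∀ y, y ∈ (φ.trans B.symm).source ↔ y ∈ φ.source ∧ φ y ∈ Metric.ball (0 : ℂ) r := by
    intro y
    rw [OpenPartialHomeomorph.trans_source, OpenPartialHomeomorph.symm_source, hBt]
    rfl
  refine ⟨φ.trans B.symm, ⟨?_, ?_, ?_⟩, fun y hy => ?_, fun y hy z hz => ?_⟩
  · rw [hsrc, h0]
    exact ⟨hx, Metric.mem_ball_self hr⟩
  · rw [OpenPartialHomeomorph.coe_trans, Function.comp_apply, h0]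
    exact OpenPartialHomeomorph.univBall_symm_apply_center _ _
  · refine Set.eq_univ_of_forall fun z => ?_
    rw [OpenPartialHomeomorph.trans_target, OpenPartialHomeomorph.symm_target, hBs]
    refine ⟨Set.mem_univ _, (hrV ?_).1⟩
    rw [OpenPartialHomeomorph.symm_symm, ← hBt]
    exact B.map_source (hBs ▸ Set.mem_univ z)
  · rw [hsrc] at hy
    have := (hrV hy.2).2
    rw [Set.mem_preimage, φ.left_inv hy.1] at this
    exact ⟨this, hy.1⟩
  · have key : ∀ y ∈ (φ.trans B.symm).source, ∃ t : ℝ, 0 < t ∧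
        φ y = (t : ℂ) * (φ.trans B.symm) y := by
      intro y hy
      rw [hsrc] at hy
      refine ⟨r * (√(1 + ‖(φ.trans B.symm) y‖ ^ 2))⁻¹, by positivity, ?_⟩
      rw [← univBall_apply_eq hr]
      exact (B.right_inv (hBt ▸ hy.2)).symm
    obtain ⟨s, hs, hs'⟩ := key y hy
    obtain ⟨t, ht, ht'⟩ := key z hz
    have e : φ z / φ y = ((t / s : ℝ) : ℂ) * ((φ.trans B.symm) z / (φ.trans B.symm) y) := by
      rw [hs', ht', mul_div_mul_comm, Complex.ofReal_div]
    unfold argCocycle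
    rw [e, Complex.arg_real_mul _ (div_pos ht hs)]

namespace IsDiscChart

theorem continuous_symm (hψ : IsDiscChart ψ x) : Continuous ψ.symm := by
  have := ψ.continuousOn_symm
  rwa [hψ.target_eq, continuousOn_univ] at this

theorem symm_mem (hψ : IsDiscChart ψ x) (z : ℂ) : ψ.symm z ∈ ψ.source :=
  ψ.map_target (hψ.target_eq ▸ Set.mem_univ z)

theorem apply_symm (hψ : IsDiscChart ψ x) (z : ℂ) : ψ (ψ.symm z) = z :=
  ψ.right_inv (hψ.target_eq ▸ Set.mem_univ z)

theorem symm_zero (hψ : IsDiscChart ψ x) : ψ.symm 0 = x := by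
  rw [← hψ.apply_center, ψ.left_inv hψ.mem_source]

theorem source_mem_nhds (hψ : IsDiscChart ψ x) : ψ.source ∈ 𝓝 x :=
  ψ.open_source.mem_nhds hψ.mem_source

theorem apply_ne_zero (hψ : IsDiscChart ψ x) {y : X} (hy : y ∈ ψ.source) (hyx : y ≠ x) :
    ψ y ≠ 0 := by
  rw [← hψ.apply_center]
  exact fun h => hyx (ψ.injOn hy hψ.mem_source h)

theorem symm_ne (hψ : IsDiscChart ψ x) {z : ℂ} (hz : z ≠ 0) : ψ.symm z ≠ x := by
  intro h
  apply hz
  rw [← hψ.apply_symm z, h, hψ.apply_center]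

theorem contractible (hψ : IsDiscChart ψ x) : ContractibleSpace ψ.source := by
  have e : ψ.source ≃ₜ ℂ := ψ.toHomeomorphSourceTarget.trans
    ((Homeomorph.setCongr hψ.target_eq).trans (Homeomorph.Set.univ ℂ))
  exact e.contractibleSpace

theorem potentialAt_of_symm {D : X → X → ℝ} {h : ℂ → ℝ} {y : X}
    (hy : y ∈ ψ.source) (h1 : PotentialAt (fun a b => D (ψ.symm a) (ψ.symm b)) h (ψ y)) :
    PotentialAt D (h ∘ ψ) y := by
  have h2 := h1.comp (ψ.continuousAt hy)
  filter_upwards [h2, ψ.open_source.mem_nhds hy] with z h3 h4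
  rwa [ψ.left_inv hy, ψ.left_inv h4] at h3

/-- On a disc every cocycle has a potential. -/
theorem exists_potential (hψ : IsDiscChart ψ x) {D : X → X → ℝ}
    (hD : ∀ y ∈ ψ.source, CocycleAt D y) : ∃ h : X → ℝ, ∀ y ∈ ψ.source, PotentialAt D h y := by
  obtain ⟨l, hl⟩ := SurfaceBraid.exists_potential (fun a b => D (ψ.symm a) (ψ.symm b)) fun z =>
    (hD _ (hψ.symm_mem z)).comp (.of_forall fun _ => hψ.continuous_symm.continuousAt)
  exact ⟨l ∘ ψ, fun y hy => potentialAt_of_symm hy (hl _)⟩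

/-- On a punctured disc every cocycle is a multiple of the angle, up to a potential. -/
theorem exists_residue_on (hψ : IsDiscChart ψ x) {D : X → X → ℝ}
    (hD : ∀ y ∈ ψ.source, y ≠ x → CocycleAt D y) :
    ∃ (c : ℝ) (h : X → ℝ), ∀ y ∈ ψ.source, y ≠ x → PotentialAt (D - c • argCocycle ψ) h y := by
  obtain ⟨c, l, hl⟩ := exists_residue_punctured_plane
    (D := fun a b => D (ψ.symm a) (ψ.symm b)) fun z hz =>
    (hD _ (hψ.symm_mem z) (hψ.symm_ne hz)).comp
      (.of_forall fun _ => hψ.continuous_symm.continuousAt)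
  refine ⟨c, l ∘ ψ, fun y hy hyx => potentialAt_of_symm hy ?_⟩
  convert hl _ (hψ.apply_ne_zero hy hyx) using 1
  ext a b
  simp [argCocycle, hψ.apply_symm]

theorem eq_zero_of_circle (hψ : IsDiscChart ψ x) {c r : ℝ} (hr : 0 < r) {k : X → ℝ}
    (hk : ∀ y ∈ ψ.source, ‖ψ y‖ = r → PotentialAt (c • argCocycle ψ) k y) : c = 0 := by
  refine eq_zero_of_potentialAt_circle hr (k := k ∘ ψ.symm) fun y hy => ?_
  have := (hk _ (hψ.symm_mem y) (by rwa [hψ.apply_symm])).comp hψ.continuous_symm.continuousAt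
  convert this using 1
  ext a b
  simp [argCocycle, hψ.apply_symm]

theorem tendsto_symm_punctured (hψ : IsDiscChart ψ x) : Tendsto ψ.symm (𝓝[≠] 0) (𝓝[≠] x) := by
  refine tendsto_nhdsWithin_iff.2 ⟨?_, ?_⟩
  · have := hψ.continuous_symm.tendsto 0
    rw [hψ.symm_zero] at this
    exact this.mono_left nhdsWithin_le_nhds
  · filter_upwards [self_mem_nhdsWithin] with z hz
    exact hψ.symm_ne hz

theorem eq_zero_of_residueFree (hψ : IsDiscChart ψ x) {c : ℝ}
    (hc : ResidueFree (c • argCocycle ψ) x) : c = 0 := by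
  obtain ⟨k, hk⟩ := hc
  have h1 := hψ.tendsto_symm_punctured.eventually hk
  rw [eventually_nhdsWithin_iff, Metric.eventually_nhds_iff] at h1
  obtain ⟨r, hr, h2⟩ := h1
  refine hψ.eq_zero_of_circle (half_pos hr) (k := k) fun y hy hyr => ?_
  have h3 := h2 (y := ψ y) (by rw [dist_zero_right, hyr]; linarith) (by
    intro h
    rw [Set.mem_singleton_iff] at h
    rw [h, norm_zero] at hyr
    linarith)
  rwa [ψ.left_inv hy] at h3

theorem residueFree_of_cocycleAt (hψ : IsDiscChart ψ x) {D : X → X → ℝ}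
    (hD : ∀ᶠ y in 𝓝 x, CocycleAt D y) : ResidueFree D x := by
  obtain ⟨ψ', hψ', hs, -⟩ := exists_discChart_subset hψ.mem_source hψ.apply_center hD
  obtain ⟨h, hh⟩ := hψ'.exists_potential fun y hy => (hs hy).1
  exact ⟨h, nhdsWithin_le_nhds (mem_of_superset hψ'.source_mem_nhds hh)⟩

theorem exists_residue (hψ : IsDiscChart ψ x) {D : X → X → ℝ}
    (hD : ∀ᶠ y in 𝓝[≠] x, CocycleAt D y) : ∃ c : ℝ, ResidueFree (D - c • argCocycle ψ) x := by
  rw [eventually_nhdsWithin_iff] at hD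
  obtain ⟨ψ', hψ', hs, ha⟩ := exists_discChart_subset hψ.mem_source hψ.apply_center hD
  obtain ⟨c, h, hh⟩ := hψ'.exists_residue_on fun y hy hyx => (hs hy).1 hyx
  refine ⟨c, h, ?_⟩
  rw [eventually_nhdsWithin_iff]
  filter_upwards [hψ'.source_mem_nhds] with y hy hyx
  filter_upwards [hh y hy hyx, ψ'.open_source.mem_nhds hy] with z h1 h2
  rw [← h1]
  simp only [Pi.sub_apply, Pi.smul_apply, ha y hy z h2]

theorem cocycleAt_arg (hψ : IsDiscChart ψ x) {y : X} (hy : y ∈ ψ.source) (hyx : y ≠ x) :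
    CocycleAt (argCocycle ψ) y :=
  SurfaceBraid.cocycleAt_argCocycle
    (by filter_upwards [ψ.open_source.mem_nhds hy] with z hz using ψ.continuousAt hz)
    (hψ.apply_ne_zero hy hyx)

end IsDiscChart

/-- The translate of a chart that vanishes at `x'`. -/
def translateChart (ψ : OpenPartialHomeomorph X ℂ) (x' : X) : OpenPartialHomeomorph X ℂ :=
  ψ.trans (Homeomorph.subRight (ψ x')).toOpenPartialHomeomorph

theorem translateChart_source (ψ : OpenPartialHomeomorph X ℂ) (x' : X) :
    (translateChart ψ x').source = ψ.source := by
  simp [translateChart]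

theorem translateChart_apply (ψ : OpenPartialHomeomorph X ℂ) (x' y : X) :
    translateChart ψ x' y = ψ y - ψ x' := rfl

theorem IsDiscChart.recenter (hψ : IsDiscChart ψ x) {x' : X} (hx' : x' ∈ ψ.source) :
    IsDiscChart (translateChart ψ x') x' where
  mem_source := by rwa [translateChart_source]
  apply_center := by rw [translateChart_apply, sub_self]
  target_eq := by simp [translateChart, hψ.target_eq]

end Charts

/-! ### Moving residues, and their homotopy invariance -/

section Residues
variable {X : Type*} [TopologicalSpace X] {ψ : OpenPartialHomeomorph X ℂ} {x : X}

/-- Inside a disc chart there is a cocycle on the complement of two points whose residues there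
are opposite. It is the argument of `ψ / (ψ - ψ x')`, cut off outside the unit disc. -/
theorem IsDiscChart.exists_exchange [T2Space X] (hψ : IsDiscChart ψ x) {x' : X}
    (hx' : x' ∈ ψ.source) (hlt : ‖ψ x'‖ < 1) (hne : x' ≠ x) :
    ∃ E : X → X → ℝ, (∀ y, y ≠ x → y ≠ x' → CocycleAt E y) ∧
      ResidueFree (E - argCocycle ψ) x ∧ ResidueFree (E + argCocycle (translateChart ψ x')) x' := by
  classical
  let g : X → ℂ := fun y => if y ∈ ψ.source then ψ y / (ψ y - ψ x') else 1
  let E : X → X → ℝ := fun y z => argCocycle g y z - ((g z).arg - (g y).arg)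
  let B : Set X := ψ.symm '' Metric.closedBall 0 1
  have hB : IsClosed B := ((isCompact_closedBall 0 1).image hψ.continuous_symm).isClosed
  have hgs : ∀ y ∈ ψ.source, g =ᶠ[𝓝 y] (ψ / (translateChart ψ x' : X → ℂ)) := by
    intro y hy
    filter_upwards [ψ.open_source.mem_nhds hy] with z hz
    simp [g, hz, translateChart_apply]
  have hψc : ∀ y ∈ ψ.source, ContinuousAt ψ y := fun y hy => ψ.continuousAt hy
  have hψc' : ∀ y ∈ ψ.source, ContinuousAt (translateChart ψ x') y := fun y hy =>
    (translateChart ψ x').continuousAt (by rwa [translateChart_source])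
  have hne' : ∀ y ∈ ψ.source, y ≠ x' → translateChart ψ x' y ≠ 0 := fun y hy =>
    (hψ.recenter hx').apply_ne_zero (by rwa [translateChart_source])
  have hE : ∀ y ∈ ψ.source, y ≠ x → y ≠ x' →
      PotentialAt (E - (argCocycle ψ - argCocycle (translateChart ψ x'))) (fun y => -(g y).arg) y := by
    intro y hy h1 h2
    have h3 := potentialAt_argCocycle_div (hψc y hy) (hψc' y hy) (hψ.apply_ne_zero hy h1)
      (hne' y hy h2)
    filter_upwards [h3, hgs y hy] with z h4 h5
    have h6 := (hgs y hy).self_of_nhds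
    simp only [Pi.sub_apply, E, argCocycle, h5, h6, Pi.div_apply, Pi.zero_apply] at h4 ⊢
    linarith
  have hA : ∀ y ∈ ψ.source, y ≠ x → CocycleAt (argCocycle ψ) y := fun y hy h =>
    hψ.cocycleAt_arg hy h
  have hA' : ∀ y ∈ ψ.source, y ≠ x' → CocycleAt (argCocycle (translateChart ψ x')) y := fun y hy h =>
    (hψ.recenter hx').cocycleAt_arg (by rwa [translateChart_source]) h
  have hopen : ∀ y ∈ ψ.source, y ≠ x → y ≠ x' →
      ∀ᶠ z in 𝓝 y, z ∈ ψ.source ∧ z ≠ x ∧ z ≠ x' := fun y hy h1 h2 =>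
    (ψ.open_source.eventually_mem hy).and
      ((isOpen_ne.eventually_mem h1).and (isOpen_ne.eventually_mem h2))
  have hpos : ∀ y ∉ B, 0 < (g y).re := by
    intro y hy
    by_cases hys : y ∈ ψ.source
    · have h1 : 1 < ‖ψ y‖ := by
        by_contra! h
        exact hy ⟨ψ y, by simpa using h, ψ.left_inv hys⟩
      have h0 : ψ y ≠ 0 := by
        rw [← norm_pos_iff]
        linarith
      have h2 : g y = (1 - ψ x' / ψ y)⁻¹ := by
        simp only [g, hys, if_true]
        rw [one_sub_div h0, inv_div]
      rw [h2]
      refine inv_re_pos ?_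
      have h3 : ‖ψ x' / ψ y‖ < 1 := by
        rw [norm_div, div_lt_one (by linarith)]
        linarith
      have h4 := (Complex.re_le_norm (ψ x' / ψ y))
      rw [Complex.sub_re, Complex.one_re]
      linarith
    · simp [g, hys]
  refine ⟨E, fun y h1 h2 => ?_, ?_, ?_⟩
  · by_cases hy : y ∈ B
    · obtain ⟨z, -, rfl⟩ := hy
      have hys := hψ.symm_mem z
      refine ((hA _ hys h1).sub (hA' _ hys h2)).of_sub (h := fun y => -(g y).arg) ?_
      filter_upwards [hopen _ hys h1 h2] with w hw using hE w hw.1 hw.2.1 hw.2.2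
    · refine CocycleAt.of_potentialAt (h := 0) ?_
      filter_upwards [hB.isOpen_compl.mem_nhds hy] with z hz
      filter_upwards [hB.isOpen_compl.mem_nhds hz] with w hw
      simp only [E, argCocycle, Pi.zero_apply]
      rw [div_eq_mul_inv, arg_mul_of_re_pos (hpos w hw) (inv_re_pos (hpos z hz)),
        arg_inv_of_re_pos (hpos z hz)]
      ring
  · obtain ⟨k, hk⟩ := hψ.residueFree_of_cocycleAt (D := argCocycle (translateChart ψ x')) (by
      filter_upwards [ψ.open_source.mem_nhds hψ.mem_source, isOpen_ne.mem_nhds hne.symm]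
        with z hz hz' using hA' z hz hz')
    refine ⟨(fun y => -(g y).arg) - k, ?_⟩
    · rw [eventually_nhdsWithin_iff] at hk ⊢
      filter_upwards [hk, hψ.source_mem_nhds, isOpen_ne.mem_nhds hne.symm] with y h1 h2 h3 h4
      have h5 := (hE y h2 h4 h3).sub (h1 h4)
      convert h5 using 1
      abel
  · obtain ⟨k, hk⟩ := (hψ.recenter hx').residueFree_of_cocycleAt (D := argCocycle ψ) (by
      filter_upwards [ψ.open_source.mem_nhds hx', isOpen_ne.mem_nhds hne]
        with z hz hz' using hA z hz hz')
    refine ⟨(fun y => -(g y).arg) + k, ?_⟩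
    · rw [eventually_nhdsWithin_iff] at hk ⊢
      filter_upwards [hk, ψ.open_source.mem_nhds hx', isOpen_ne.mem_nhds hne] with y h1 h2 h3 h4
      have h5 := (hE y h2 h3 h4).add (h1 h4)
      convert h5 using 1
      abel

/-- The residue of the angle of a nonvanishing function does not change under small
deformations. -/
theorem IsDiscChart.eventually_residueFree_argCocycle_sub (hψ : IsDiscChart ψ x) {T : Type*}
    [TopologicalSpace T] {t₀ : T} {T₀ : Set T} (hT₀ : T₀ ∈ 𝓝 t₀) {B : T → X → ℂ}
    (hB : ∀ t ∈ T₀, ∀ y ∈ ψ.source, ContinuousAt (fun q : T × X => B q.1 q.2) (t, y))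
    (h0 : ∀ t ∈ T₀, ∀ y ∈ ψ.source, y ≠ x → B t y ≠ 0) :
    ∀ᶠ t in 𝓝 t₀, ResidueFree (argCocycle (B t) - argCocycle (B t₀)) x := by
  have ht₀ := mem_of_mem_nhds hT₀
  have hBt : ∀ t ∈ T₀, ∀ y ∈ ψ.source, ContinuousAt (B t) y := fun t ht y hy =>
    (hB t ht y hy).comp (f := fun y => (t, y)) (by fun_prop)
  have hcoc : ∀ t ∈ T₀, ∀ y ∈ ψ.source, y ≠ x → CocycleAt (argCocycle (B t)) y :=
    fun t ht y hy hyx => cocycleAt_argCocycle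
      (by filter_upwards [ψ.open_source.mem_nhds hy] with z hz using hBt t ht z hz)
      (h0 t ht y hy hyx)
  have hcircle : ∀ z : ℂ, ‖z‖ = 1 → ψ.symm z ≠ x := fun z hz =>
    hψ.symm_ne (by rintro rfl; simp at hz)
  have hnear : ∀ᶠ t in 𝓝 t₀, ∀ z ∈ Metric.sphere (0 : ℂ) 1,
      0 < (B t (ψ.symm z) / B t₀ (ψ.symm z)).re := by
    refine (isCompact_sphere (0 : ℂ) 1).eventually_forall_of_forall_eventually
      (P := fun t z => 0 < (B t (ψ.symm z) / B t₀ (ψ.symm z)).re) fun z hz => ?_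
    have hz' : ‖z‖ = 1 := by simpa using hz
    have hs := hψ.symm_mem z
    have h00 := h0 t₀ ht₀ _ hs (hcircle z hz')
    have hc : ContinuousAt (fun q : T × ℂ => ((B q.1 (ψ.symm q.2)) / B t₀ (ψ.symm q.2)).re)
        (t₀, z) := by
      refine Complex.continuous_re.continuousAt.comp (ContinuousAt.div ?_ ?_ h00)
      · exact ContinuousAt.comp (x := (t₀, z)) (f := fun q : T × ℂ => (q.1, ψ.symm q.2))
          (hB t₀ ht₀ _ hs)
          (continuous_fst.prodMk (hψ.continuous_symm.comp continuous_snd)).continuousAt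
      · exact ContinuousAt.comp (x := (t₀, z)) (f := fun q : T × ℂ => ψ.symm q.2)
          (hBt t₀ ht₀ _ hs) (hψ.continuous_symm.comp continuous_snd).continuousAt
    refine hc.eventually (lt_mem_nhds ?_)
    simp [div_self h00]
  filter_upwards [hnear, hT₀] with t ht htT
  obtain ⟨c, h, hh⟩ := hψ.exists_residue_on (D := argCocycle (B t) - argCocycle (B t₀))
    fun y hy hyx => (hcoc t htT y hy hyx).sub (hcoc t₀ ht₀ y hy hyx)
  have hc : c = 0 := by
    refine hψ.eq_zero_of_circle one_pos
      (k := (fun y => ((B t / B t₀) y).arg) - 0 - h) fun y hy hy1 => ?_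
    have hyx : y ≠ x := by
      rintro rfl
      rw [hψ.apply_center, norm_zero] at hy1
      exact zero_ne_one hy1
    have h1 := potentialAt_argCocycle_div (hBt t htT y hy) (hBt t₀ ht₀ y hy) (h0 t htT y hy hyx)
      (h0 t₀ ht₀ y hy hyx)
    have h2 := ht (ψ y) (by simpa using hy1)
    rw [ψ.left_inv hy] at h2
    have h3 := potentialAt_argCocycle_of_re_pos
      ((hBt t htT y hy).div (hBt t₀ ht₀ y hy) (h0 t₀ ht₀ y hy hyx)) h2
    have h4 := (h3.sub h1).sub (hh y hy hyx)
    convert h4 using 1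
    change _ = argCocycle (B t / B t₀) - _ - _
    abel
  refine ⟨h, ?_⟩
  rw [eventually_nhdsWithin_iff]
  filter_upwards [hψ.source_mem_nhds] with y hy hyx
  have := hh y hy hyx
  rwa [hc, zero_smul, sub_zero] at this

end Residues

/-! ### Dipoles and the orientation of a surface -/

section Orientation
variable {X : Type*} [TopologicalSpace X] {x x' : X} {ψ ψ' : OpenPartialHomeomorph X ℂ}
  {D E : X → X → ℝ}

/-- `E` is a cocycle on the complement of `x` and `x'` with residue `1` at `x` in the chart `ψ` and
residue `-1` at `x'` in the chart `ψ'`. -/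
structure IsDipole (E : X → X → ℝ) (ψ ψ' : OpenPartialHomeomorph X ℂ) (x x' : X) : Prop where
  cocycleAt : ∀ y, y ≠ x → y ≠ x' → CocycleAt E y
  left : ResidueFree (E - argCocycle ψ) x
  right : ResidueFree (E + argCocycle ψ') x'

theorem IsDipole.symm (hE : IsDipole E ψ ψ' x x') : IsDipole (-E) ψ' ψ x' x where
  cocycleAt y h h' := by
    have := (hE.cocycleAt y h' h).smul (-1)
    rwa [neg_one_smul] at this
  left := by
    have := hE.right.neg
    rwa [neg_add, ← sub_eq_add_neg] at this
  right := by
    have := hE.left.neg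
    rwa [neg_sub, sub_eq_neg_add] at this

theorem ResidueFree.exists_extension_cocycle [T1Space X] (hD : ResidueFree D x) :
    ∃ D' : X → X → ℝ, CocycleAt D' x ∧ (∀ y ≠ x, CocycleAt D y → CocycleAt D' y) ∧
      ∀ y ≠ x, ResidueFree (D' - D) y := by
  obtain ⟨D', k, h1, h2⟩ := hD.exists_extension
  have h3 : ∀ y ≠ x, ∀ᶠ z in 𝓝 y, PotentialAt (D' - D) k z := fun y hy => by
    filter_upwards [isOpen_ne.mem_nhds hy] with z hz using h2 z hz
  exact ⟨D', h1, fun y hy hD => hD.of_sub (h3 y hy),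
    fun y hy => ⟨k, nhdsWithin_le_nhds (h3 y hy)⟩⟩

/-- Subtracting a multiple of a dipole moves the singularity of `D` from `x` to `x'`: the result
extends over `x`. -/
theorem IsDipole.exists_moved [T1Space X] (hE : IsDipole E ψ ψ' x x') {c : ℝ}
    (hD : ResidueFree (D - c • argCocycle ψ) x) :
    ∃ D' : X → X → ℝ, CocycleAt D' x ∧ (∀ y, y ≠ x → y ≠ x' → CocycleAt D y → CocycleAt D' y) ∧
      ∀ y ≠ x, ResidueFree (D' - (D - c • E)) y := by
  have h1 : ResidueFree (D - c • E) x := by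
    have := hD.sub (hE.left.smul c)
    convert this using 1
    module
  obtain ⟨D', h2, h3, h4⟩ := h1.exists_extension_cocycle
  exact ⟨D', h2, fun y hy hy' hDy => h3 y hy (hDy.sub ((hE.cocycleAt y hy hy').smul c)), h4⟩

/-- The residue theorem at `x`: a cocycle whose only singularity is `x` has no residue there. -/
def ResidueTheorem (x : X) : Prop :=
  ∀ D : X → X → ℝ, (∀ y ≠ x, CocycleAt D y) → ResidueFree D x

theorem residueFree_of_ne [T1Space X] {y : X} {s : Set X} (hs : s.Finite) (hψ : IsDiscChart ψ y)
    (hD : ∀ z ∉ s, CocycleAt D z) (hy : y ∉ s) : ResidueFree D y :=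
  hψ.residueFree_of_cocycleAt (by
    filter_upwards [hs.isClosed.isOpen_compl.mem_nhds hy] with z hz using hD z hz)

theorem IsDipole.residueTheorem [T1Space X] (hE : IsDipole E ψ ψ' x x') (hne : x ≠ x')
    (hψ : IsDiscChart ψ x) (hψ' : IsDiscChart ψ' x') (hR : ResidueTheorem x') :
    ResidueTheorem x := by
  intro D hD
  obtain ⟨c, hc⟩ := hψ.exists_residue (D := D) (by
    filter_upwards [self_mem_nhdsWithin] with y hy using hD y hy)
  obtain ⟨D', h1, h2, h3⟩ := hE.exists_moved hc
  have h4 : ResidueFree D' x' := hR D' fun y hy => by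
    by_cases hyx : y = x
    · rwa [hyx]
    · exact h2 y hyx hy (hD y hyx)
  have h5 : ResidueFree D x' :=
    residueFree_of_ne (Set.finite_singleton x) hψ' hD (by simpa using hne.symm)
  have h6 : ResidueFree (c • argCocycle ψ') x' := by
    have := ((h4.sub (h3 x' hne.symm)).sub h5).add (hE.right.smul c)
    convert this using 1
    module
  have h7 := hψ'.eq_zero_of_residueFree h6
  rwa [h7, zero_smul, sub_zero] at hc

/-- Nearby points are the ends of a dipole. -/
theorem IsDiscChart.exists_dipole [T2Space X] (hψ : IsDiscChart ψ x) :
    ∀ᶠ x' in 𝓝 x, x' ∈ ψ.source ∧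
      (x' ≠ x → ∃ E, IsDipole E ψ (translateChart ψ x') x x') := by
  have h1 : ∀ᶠ x' in 𝓝 x, ‖ψ x'‖ < 1 := by
    refine (ψ.continuousAt hψ.mem_source).norm.eventually (gt_mem_nhds ?_)
    simp [hψ.apply_center]
  filter_upwards [hψ.source_mem_nhds, h1] with x' hx' hlt
  refine ⟨hx', fun hne => ?_⟩
  obtain ⟨E, h2, h3, h4⟩ := hψ.exists_exchange hx' hlt hne
  exact ⟨E, h2, h3, h4⟩

theorem forall_of_eventually_iff [PreconnectedSpace X] {P : X → Prop}
    (hP : ∀ x, ∀ᶠ x' in 𝓝 x, P x ↔ P x') (hx : P x) (y : X) : P y := by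
  have h : IsClopen {x | P x} := by
    refine ⟨isOpen_compl_iff.1 (isOpen_iff_mem_nhds.2 fun z hz => ?_),
      isOpen_iff_mem_nhds.2 fun z hz => ?_⟩
    · filter_upwards [hP z] with w hw using fun h => hz (hw.2 h)
    · filter_upwards [hP z] with w hw using hw.1 hz
  have := h.eq_univ ⟨x, hx⟩
  exact (Set.ext_iff.1 this y).2 (Set.mem_univ y)

/-- If the residue theorem holds at one point of a connected surface, it holds everywhere, since
dipoles move residues to nearby points. -/
theorem ResidueTheorem.forall [T2Space X] [PreconnectedSpace X]
    (hX : ∀ x : X, ∃ ψ, IsDiscChart ψ x) (hx : ResidueTheorem x) (y : X) : ResidueTheorem y := by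
  refine forall_of_eventually_iff (fun x => ?_) hx y
  obtain ⟨ψ, hψ⟩ := hX x
  filter_upwards [hψ.exists_dipole] with x' ⟨hx', h⟩
  by_cases hne : x' = x
  · rw [hne]
  · obtain ⟨E, hE⟩ := h hne
    exact ⟨hE.symm.residueTheorem hne (hψ.recenter hx') hψ,
      hE.residueTheorem (Ne.symm hne) hψ (hψ.recenter hx')⟩

variable {q : X} {ψq : OpenPartialHomeomorph X ℂ} {u : X → X → ℝ}

/-- `u` is a cocycle on the complement of `q` and `x` with residue `1` at `q`. -/
structure HasPole (u : X → X → ℝ) (ψq : OpenPartialHomeomorph X ℂ) (q x : X) : Prop where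
  cocycleAt : ∀ y, y ≠ q → y ≠ x → CocycleAt u y
  residue : ResidueFree (u - argCocycle ψq) q

theorem HasPole.move [T1Space X] (hu : HasPole u ψq q x) (hq : IsDiscChart ψq q)
    (hE : IsDipole E ψ ψ' x x') (hψ : IsDiscChart ψ x) (hxq : x ≠ q) (hxq' : x' ≠ q) :
    ∃ u', HasPole u' ψq q x' := by
  obtain ⟨c, hc⟩ := hψ.exists_residue (D := u) (by
    rw [eventually_nhdsWithin_iff]
    filter_upwards [isOpen_ne.mem_nhds hxq] with y hy hy' using hu.cocycleAt y hy hy')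
  obtain ⟨u', h1, h2, h3⟩ := hE.exists_moved hc
  refine ⟨u', fun y hyq hyx' => ?_, ?_⟩
  · by_cases hyx : y = x
    · rwa [hyx]
    · exact h2 y hyx hyx' (hu.cocycleAt y hyq hyx)
  · have h4 : ResidueFree E q := residueFree_of_ne (s := {x, x'}) (by simp) hq
      (fun z hz => hE.cocycleAt z (fun h => hz (by simp [h])) fun h => hz (by simp [h]))
      (by simp [hxq.symm, hxq'.symm])
    have := ((h3 q hxq.symm).add hu.residue).sub (h4.smul c)
    convert this using 1
    module

/-- For every other point `x` there is a cocycle with residue `1` at `q` whose only further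
singularity is `x`: near `q` it is a dipole, and the second singularity can be moved along the
connected surface. -/
theorem exists_hasPole [T2Space X] [PreconnectedSpace X] (hX : ∀ x : X, ∃ ψ, IsDiscChart ψ x)
    (hq : IsDiscChart ψq q) (x : X) (hx : x ≠ q) : ∃ u, HasPole u ψq q x := by
  refine (forall_of_eventually_iff (P := fun x => x = q ∨ ∃ u, HasPole u ψq q x) (x := q)
    (fun x => ?_) (Or.inl rfl) x).resolve_left hx
  by_cases hxq : x = q
  · subst hxq
    filter_upwards [hq.exists_dipole] with x' ⟨hx', h⟩
    refine ⟨fun _ => ?_, fun _ => Or.inl rfl⟩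
    by_cases hne : x' = x
    · exact Or.inl hne
    · obtain ⟨E, hE⟩ := h hne
      exact Or.inr ⟨E, hE.cocycleAt, hE.left⟩
  · obtain ⟨ψ, hψ⟩ := hX x
    filter_upwards [hψ.exists_dipole, isOpen_ne.mem_nhds hxq] with x' ⟨hx', h⟩ hxq'
    by_cases hne : x' = x
    · rw [hne]
    · have hxq'' : x' ≠ q := hxq'
      obtain ⟨E, hE⟩ := h hne
      simp only [hxq, hxq'', false_or]
      exact ⟨fun ⟨u, hu⟩ => hu.move hq hE hψ hxq hxq'',
        fun ⟨u, hu⟩ => hu.move hq hE.symm (hψ.recenter hx') hxq'' hxq⟩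

/-- The second singularity is not removable, by the residue theorem at `q`. -/
theorem HasPole.not_residueFree [T1Space X] (hu : HasPole u ψq q x) (hq : IsDiscChart ψq q)
    (hxq : x ≠ q) (hR : ResidueTheorem q) : ¬ ResidueFree u x := by
  intro h
  obtain ⟨D, h1, h2, h3⟩ := h.exists_extension_cocycle
  have h4 : ResidueFree D q := hR D fun y hy => by
    by_cases hyx : y = x
    · rwa [hyx]
    · exact h2 y hyx (hu.cocycleAt y hy hyx)
  have h5 : ResidueFree ((1 : ℝ) • argCocycle ψq) q := by
    have := (h4.sub (h3 q hxq.symm)).sub hu.residue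
    convert this using 1
    module
  exact one_ne_zero (hq.eq_zero_of_residueFree h5)

/-- The germ at `x'` of a cocycle with singularities `q` and `x'` only is determined by its germ
at `q`. -/
theorem ResidueTheorem.residueFree_of_pair [T1Space X] (hR : ResidueTheorem x')
    (hD : ∀ y, y ≠ q → y ≠ x' → CocycleAt D y) (hDq : ResidueFree D q) (hne : x' ≠ q) :
    ResidueFree D x' := by
  obtain ⟨D', h1, h2, h3⟩ := hDq.exists_extension_cocycle
  have h4 : ResidueFree D' x' := hR D' fun y hy => by
    by_cases hyq : y = q
    · rwa [hyq]
    · exact h2 y hyq (hD y hyq hy)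
  have := h4.sub (h3 x' hne)
  rwa [sub_sub_cancel] at this

theorem argCocycle_translateChart_self (hψ : IsDiscChart ψ x) :
    argCocycle (translateChart ψ x) = argCocycle ψ := by
  ext y z
  simp [argCocycle, translateChart_apply, hψ.apply_center]

/-- `ω` is a coherent choice of a nonzero multiple of an angle germ at every point, up to
potentials: locally it is a constant multiple of the angles in the translates of one chart. -/
def IsOrientation (ω : X → X → X → ℝ) : Prop :=
  ∀ x, ∃ (χ : OpenPartialHomeomorph X ℂ) (c : ℝ), IsDiscChart χ x ∧ c ≠ 0 ∧
    ∀ᶠ x' in 𝓝 x, x' ∈ χ.source ∧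
      ResidueFree (ω x' - c • argCocycle (translateChart χ x')) x'

/-- The residue theorem makes a connected surface orientable: cocycles with a fixed residue at `q`
and one more singularity at `x` have a well-defined germ there, varying coherently with `x`. -/
theorem exists_isOrientation [T2Space X] [ConnectedSpace X] (hX : ∀ x : X, ∃ ψ, IsDiscChart ψ x)
    (hR : ∀ x : X, ResidueTheorem x) : ∃ ω : X → X → X → ℝ, IsOrientation ω := by
  classical
  obtain ⟨q⟩ : Nonempty X := inferInstance
  obtain ⟨ψq, hq⟩ := hX q
  choose u hu using fun (x : X) (hx : x ≠ q) => exists_hasPole hX hq x hx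
  refine ⟨fun x => if hx : x = q then argCocycle ψq else -u x hx, fun x => ?_⟩
  by_cases hxq : x = q
  · subst hxq
    refine ⟨ψq, 1, hq, one_ne_zero, ?_⟩
    filter_upwards [hq.exists_dipole] with x' ⟨hx', h⟩
    refine ⟨hx', ?_⟩
    by_cases hne : x' = x
    · subst hne
      simpa [argCocycle_translateChart_self hq] using ResidueFree.zero
    · obtain ⟨E, hE⟩ := h hne
      have hu' := hu x' hne
      have h1 : ResidueFree (u x' hne - E) x' := (hR x').residueFree_of_pair
        (fun y hy hy' => (hu'.cocycleAt y hy hy').sub (hE.cocycleAt y hy hy'))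
        (by
          have := hu'.residue.sub hE.left
          rwa [sub_sub_sub_cancel_right] at this) hne
      have := (h1.add hE.right).neg
      convert this using 1
      simp only [hne, dif_neg, not_false_eq_true]
      module
  · obtain ⟨ψ, hψ⟩ := hX x
    have hux := hu x hxq
    obtain ⟨c, hc⟩ := hψ.exists_residue (D := u x hxq) (by
      rw [eventually_nhdsWithin_iff]
      filter_upwards [isOpen_ne.mem_nhds hxq] with y hy hy' using hux.cocycleAt y hy hy')
    refine ⟨ψ, -c, hψ, ?_, ?_⟩
    · intro h0
      rw [neg_eq_zero] at h0
      rw [h0, zero_smul, sub_zero] at hc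
      exact hux.not_residueFree hq hxq (hR q) hc
    filter_upwards [hψ.exists_dipole, isOpen_ne.mem_nhds hxq] with x' ⟨hx', h⟩ hxq''
    have hxq' : x' ≠ q := hxq''
    refine ⟨hx', ?_⟩
    simp only [hxq', dif_neg, not_false_eq_true]
    by_cases hne : x' = x
    · subst hne
      rw [argCocycle_translateChart_self hψ]
      have := hc.neg
      convert this using 1
      module
    · obtain ⟨E, hE⟩ := h hne
      have hu' := hu x' hxq'
      obtain ⟨D, h1, h2, h3⟩ := hE.exists_moved hc
      have h4 : ResidueFree E q := residueFree_of_ne (s := {x, x'}) (by simp) hq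
        (fun z hz => hE.cocycleAt z (fun h => hz (by simp [h])) fun h => hz (by simp [h]))
        (by simp [Ne.symm hxq, hxq'.symm])
      have h5 : ResidueFree (D - u x' hxq') x' := by
        refine (hR x').residueFree_of_pair (q := q) (fun y hy hy' => ?_) ?_ hxq'
        · refine CocycleAt.sub ?_ (hu'.cocycleAt y hy hy')
          by_cases hyx : y = x
          · rwa [hyx]
          · exact h2 y hyx hy' (hux.cocycleAt y hy hyx)
        · have := (((h3 q (Ne.symm hxq)).add hux.residue).sub (h4.smul c)).sub hu'.residue
          convert this using 1
          module
      have h6 : ResidueFree (u x hxq) x' := by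
        obtain ⟨φ, hφ⟩ := hX x'
        exact residueFree_of_ne (s := {q, x}) (by simp) hφ
          (fun z hz => hux.cocycleAt z (fun h => hz (by simp [h])) fun h => hz (by simp [h]))
          (by simp [hne, hxq'])
      have := ((h5.sub (h3 x' hne)).sub h6).add (hE.right.smul c)
      convert this using 1
      module

theorem ResidueFree.comp {Y : Type*} [TopologicalSpace Y] (φ : Y ≃ₜ X) {y : Y}
    (hD : ResidueFree D (φ y)) : ResidueFree (fun a b => D (φ a) (φ b)) y := by
  obtain ⟨h, hh⟩ := hD
  have ht : Tendsto φ (𝓝[≠] y) (𝓝[≠] (φ y)) := by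
    refine tendsto_nhdsWithin_iff.2
      ⟨φ.continuous.continuousAt.mono_left nhdsWithin_le_nhds, ?_⟩
    filter_upwards [self_mem_nhdsWithin] with z hz using fun h => hz (φ.injective h)
  refine ⟨h ∘ φ, ?_⟩
  filter_upwards [ht.eventually hh] with z hz using hz.comp φ.continuous.continuousAt

/-- Along an isotopy the pullback of the oriented angle germ at the moving point is locally
constant, up to potentials. -/
theorem IsOrientation.eventually_transport {ω : X → X → X → ℝ} (hω : IsOrientation ω)
    {F : unitInterval → (X ≃ₜ X)} (hF : Continuous fun a : unitInterval × X => F a.1 a.2)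
    {p : X} (hψ : IsDiscChart ψ p) (t₀ : unitInterval) :
    ∀ᶠ t in 𝓝 t₀, ResidueFree ((fun a b => ω (F t p) (F t a) (F t b)) -
      fun a b => ω (F t₀ p) (F t₀ a) (F t₀ b)) p := by
  obtain ⟨χ, c, hχ, -, hχω⟩ := hω (F t₀ p)
  have h1 : ∀ᶠ a : unitInterval × X in 𝓝 (t₀, p), F a.1 a.2 ∈ χ.source :=
    hF.continuousAt.eventually (χ.open_source.mem_nhds hχ.mem_source)
  rw [nhds_prod_eq, eventually_prod_iff] at h1
  obtain ⟨T, hT, U, hU, hTU⟩ := h1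
  obtain ⟨ψ', hψ', hs, -⟩ := exists_discChart_subset hψ.mem_source hψ.apply_center hU
  have h2 : ∀ᶠ t in 𝓝 t₀, F t p ∈ χ.source ∧
      ResidueFree (ω (F t p) - c • argCocycle (translateChart χ (F t p))) (F t p) := by
    have hc : Continuous fun t => F t p := hF.comp (continuous_id.prodMk continuous_const)
    exact hc.continuousAt.eventually hχω
  have h3 := hψ'.eventually_residueFree_argCocycle_sub (T₀ := {t | T t})
    (B := fun t y => χ (F t y) - χ (F t p)) hT
    (fun t ht y hy => by
      have hy' := hTU ht (hs hy).1
      have hp' := hTU ht (hs hψ'.mem_source).1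
      refine ContinuousAt.sub ?_ ?_
      · exact ContinuousAt.comp (x := (t, y)) (f := fun a : unitInterval × X => F a.1 a.2)
          (χ.continuousAt hy') hF.continuousAt
      · exact ContinuousAt.comp (x := (t, y)) (f := fun a : unitInterval × X => F a.1 p)
          (χ.continuousAt hp')
          (hF.comp (continuous_fst.prodMk continuous_const)).continuousAt)
    (fun t ht y hy hyp => by
      have hy' := hTU ht (hs hy).1
      have hp' := hTU ht (hs hψ'.mem_source).1
      rw [sub_ne_zero]
      exact fun h => hyp ((F t).injective (χ.injOn hy' hp' h)))
  filter_upwards [h2, h3] with t h4 h5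
  have h6 := h4.2.comp (F t)
  have h7 := h2.self_of_nhds.2.comp (F t₀)
  have := (h6.add (h5.smul c)).sub h7
  convert this using 1
  ext a b
  simp only [Pi.sub_apply, Pi.add_apply, Pi.smul_apply, argCocycle, translateChart_apply, smul_eq_mul]
  ring

/-- A homeomorphism isotopic to the identity preserves residues at its fixed points. -/
theorem IsOrientation.residueFree_pullback_sub {ω : X → X → X → ℝ} (hω : IsOrientation ω)
    {F : unitInterval → (X ≃ₜ X)} (hF : Continuous fun a : unitInterval × X => F a.1 a.2)
    (hF0 : F 0 = 1) {p : X} (hp : F 1 p = p) (hD : ∀ᶠ y in 𝓝[≠] p, CocycleAt D y) :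
    ResidueFree ((fun a b => D (F 1 a) (F 1 b)) - D) p := by
  obtain ⟨χ, c, hχ, hc, hχω⟩ := hω p
  have hχω := hχω.self_of_nhds.2
  rw [argCocycle_translateChart_self hχ] at hχω
  have h1 : ResidueFree ((fun a b => ω (F 1 p) (F 1 a) (F 1 b)) - ω p) p := by
    refine forall_of_eventually_iff (P := fun t =>
      ResidueFree ((fun a b => ω (F t p) (F t a) (F t b)) - ω p) p) (x := 0) (fun t₀ => ?_) ?_ 1
    · filter_upwards [hω.eventually_transport hF hχ t₀] with t ht
      constructor
      · intro h
        have := ht.add h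
        rwa [sub_add_sub_cancel] at this
      · intro h
        have := h.sub ht
        rwa [sub_sub_sub_cancel_left] at this
    · simpa [hF0] using ResidueFree.zero
  -- Subtracting a multiple of the oriented angle germ at `p` leaves a germ without residue.
  rw [hp] at h1
  obtain ⟨d, hd⟩ := hχ.exists_residue hD
  have h2 : ResidueFree (D - (d / c) • ω p) p := by
    have := hd.sub (hχω.smul (d / c))
    convert this using 1
    rw [smul_sub, smul_smul, div_mul_cancel₀ _ hc]
    module
  have h3 := ResidueFree.comp (F 1) (y := p) (D := D - (d / c) • ω p) (by rwa [hp])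
  have := (h3.add (h1.smul (d / c))).sub h2
  convert this using 1
  ext a b
  simp only [Pi.sub_apply, Pi.add_apply, Pi.smul_apply, smul_eq_mul]
  ring

end Orientation

/-! ### The polygon -/

section Polygon
variable {g : ℕ}

/-- The projection of the polygon to the surface. -/
def polygonMk (g : ℕ) (z : Metric.closedBall (0 : ℂ) 1) : PolygonSurface g := Quot.mk _ z

theorem continuous_polygonMk (g : ℕ) : Continuous (polygonMk g) := continuous_quot_mk

theorem continuous_boundaryPoint (g : ℕ) : Continuous (boundaryPoint g) := by
  unfold boundaryPoint
  fun_prop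

theorem norm_boundaryPoint (g : ℕ) (s : ℝ) : ‖(boundaryPoint g s : ℂ)‖ = 1 :=
  Complex.norm_exp_ofReal_mul_I _

theorem polygonMk_a (i : Fin g) (t : ℝ) (ht : t ∈ Set.Icc (0 : ℝ) 1) :
    polygonMk g (boundaryPoint g (4 * (i : ℕ) + t)) =
      polygonMk g (boundaryPoint g (4 * (i : ℕ) + 3 - t)) :=
  Quot.sound (SideGluing.a i t ht)

theorem polygonMk_b (i : Fin g) (t : ℝ) (ht : t ∈ Set.Icc (0 : ℝ) 1) :
    polygonMk g (boundaryPoint g (4 * (i : ℕ) + 1 + t)) =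
      polygonMk g (boundaryPoint g (4 * (i : ℕ) + 4 - t)) :=
  Quot.sound (SideGluing.b i t ht)

/-- The point of the open polygon over a point of the surface, if there is one. -/
def interiorPoint (g : ℕ) : PolygonSurface g → Option (Metric.closedBall (0 : ℂ) 1) :=
  open Classical in
  Quot.lift (fun z => if ‖(z : ℂ)‖ < 1 then some z else none) (by
    intro z w h
    cases h <;> simp [norm_boundaryPoint])

theorem interiorPoint_mk {z : Metric.closedBall (0 : ℂ) 1} (hz : ‖(z : ℂ)‖ < 1) :
    interiorPoint g (polygonMk g z) = some z := by
  change (if ‖(z : ℂ)‖ < 1 then some z else none) = some z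
  rw [if_pos hz]

theorem eq_of_polygonMk_eq {z w : Metric.closedBall (0 : ℂ) 1} (hz : ‖(z : ℂ)‖ < 1)
    (h : polygonMk g w = polygonMk g z) : w = z := by
  have h1 := interiorPoint_mk (g := g) hz
  rw [← h] at h1
  change (if ‖(w : ℂ)‖ < 1 then some w else none) = some z at h1
  split_ifs at h1 with hw
  exact Option.some_injective _ h1

/-- The projection of the polygon is open at interior points. -/
theorem nhds_polygonMk_le {z : Metric.closedBall (0 : ℂ) 1} (hz : ‖(z : ℂ)‖ < 1) :
    𝓝 (polygonMk g z) ≤ map (polygonMk g) (𝓝 z) := by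
  intro s hs
  rw [mem_map] at hs
  have hO : IsOpen {w : Metric.closedBall (0 : ℂ) 1 | ‖(w : ℂ)‖ < 1} :=
    isOpen_lt (by fun_prop) continuous_const
  obtain ⟨V, hVs, hV, hzV⟩ := mem_nhds_iff.1 (inter_mem hs (hO.mem_nhds hz))
  have hopen : IsOpen (polygonMk g '' V) := by
    refine isOpen_coinduced.2 ?_
    convert hV using 1
    ext w
    constructor
    · rintro ⟨v, hv, hvw⟩
      have := eq_of_polygonMk_eq (hVs hv).2 hvw.symm
      rwa [this]
    · exact fun hw => ⟨w, hw, rfl⟩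
  refine mem_of_superset (hopen.mem_nhds ⟨z, hzV, rfl⟩) ?_
  rintro _ ⟨v, hv, rfl⟩
  exact (hVs hv).1

/-- The boundary word of the polygon is a product of commutators, so integrals along the boundary
vanish. -/
theorem boundary_increment_eq_zero {D : PolygonSurface g → PolygonSurface g → ℝ} {l : ℝ → ℝ}
    (hl : ∀ s, PotentialAt (fun a b => D (polygonMk g (boundaryPoint g a))
      (polygonMk g (boundaryPoint g b))) l s) : l (4 * g) = l 0 := by
  -- Two sides that are glued contribute opposite increments.
  have side : ∀ c d : ℝ, (∀ t ∈ Set.Icc (0 : ℝ) 1,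
      polygonMk g (boundaryPoint g (c + t)) = polygonMk g (boundaryPoint g (d - t))) →
      l (c + 1) - l c = l (d - 1) - l d := by
    intro c d h
    have h1 : ∀ t : unitInterval, PotentialAt
        (fun a b : unitInterval => D (polygonMk g (boundaryPoint g (c + a)))
          (polygonMk g (boundaryPoint g (c + b)))) (fun a => l (c + a)) t := fun t =>
      (hl (c + t)).comp (f := fun t : unitInterval => c + (t : ℝ)) (by fun_prop)
    have h2 : ∀ t : unitInterval, PotentialAt
        (fun a b : unitInterval => D (polygonMk g (boundaryPoint g (c + a)))
          (polygonMk g (boundaryPoint g (c + b)))) (fun a => l (d - a)) t := fun t => by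
      have := (hl (d - t)).comp (f := fun t : unitInterval => d - (t : ℝ)) (by fun_prop)
      convert this using 1
      · ext a b
        rw [h a a.2, h b b.2]
      · rfl
    have := potential_increment_unique h1 h2 0 1
    simpa using this
  have step : ∀ i : Fin g, l (4 * (i : ℕ) + 4) = l (4 * (i : ℕ)) := by
    intro i
    have ha := side (4 * (i : ℕ)) (4 * (i : ℕ) + 3) (polygonMk_a i)
    have hb := side (4 * (i : ℕ) + 1) (4 * (i : ℕ) + 4) (polygonMk_b i)
    ring_nf at ha hb ⊢
    linarith
  have key : ∀ n ≤ g, l (4 * n) = l 0 := by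
    intro n
    induction n with
    | zero => simp
    | succ k ih =>
      intro hk
      rw [← ih (Nat.le_of_succ_le hk), ← step ⟨k, hk⟩]
      push_cast
      ring_nf
  exact key g le_rfl

/-- The residue theorem holds at the centre of the polygon: the cocycle is pulled back to the
closed left half plane by the exponential, where the monodromy around the centre is the integral
along the boundary. -/
theorem residueTheorem_polygon (hg : 0 < g) :
    ResidueTheorem (polygonMk g ⟨0, Metric.mem_closedBall_self zero_le_one⟩) := by
  intro D hD
  set o : PolygonSurface g := polygonMk g ⟨0, Metric.mem_closedBall_self zero_le_one⟩ with ho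
  -- The exponential is composed with the retraction of the plane onto the left half plane, so that
  -- the potential can be found on all of `ℂ`.
  have hmem : ∀ u : ℂ, Complex.exp (((min u.re 0 : ℝ) : ℂ) + u.im * Complex.I) ∈
      Metric.closedBall (0 : ℂ) 1 := fun u => by
    rw [mem_closedBall_zero_iff, Complex.norm_exp]
    simp
  let m : ℂ → Metric.closedBall (0 : ℂ) 1 := fun u => ⟨_, hmem u⟩
  have hm : Continuous m := by
    refine Continuous.subtype_mk ?_ _
    have : Continuous fun u : ℂ => min u.re 0 := Complex.continuous_re.min continuous_const
    fun_prop
  have hmo : ∀ u, polygonMk g (m u) ≠ o := fun u h => by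
    have := congrArg Subtype.val (eq_of_polygonMk_eq (by simp) h)
    exact Complex.exp_ne_zero _ this
  have hmexp : ∀ u : ℂ, u.re ≤ 0 → (m u : ℂ) = Complex.exp u := fun u hu => by
    change Complex.exp (((min u.re 0 : ℝ) : ℂ) + u.im * Complex.I) = _
    rw [min_eq_left hu, Complex.re_add_im]
  have hmper : ∀ u, m (u + 2 * Real.pi * Complex.I) = m u := fun u => by
    apply Subtype.ext
    change Complex.exp _ = Complex.exp _
    have := Complex.exp_periodic (((min u.re 0 : ℝ) : ℂ) + u.im * Complex.I)
    rw [← this]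
    congr 1
    simp
    ring
  have hmc := (continuous_polygonMk g).comp hm
  obtain ⟨l, hl⟩ := exists_potential (fun a b => D (polygonMk g (m a)) (polygonMk g (m b)))
    fun u => (hD _ (hmo u)).comp (f := fun u => polygonMk g (m u))
      (.of_forall fun _ => hmc.continuousAt)
  have hbd : ∀ s : ℝ, m (((2 * Real.pi * s / (4 * g) : ℝ) : ℂ) * Complex.I) =
      boundaryPoint g s := fun s => by
    apply Subtype.ext
    rw [hmexp _ (by rw [Complex.re_ofReal_mul]; simp)]
    rfl
  have h0 : l (2 * Real.pi * Complex.I) = l 0 := by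
    have := boundary_increment_eq_zero (D := D)
      (l := fun s => l (((2 * Real.pi * s / (4 * g) : ℝ) : ℂ) * Complex.I)) fun s => by
        have := (hl (((2 * Real.pi * s / (4 * g) : ℝ) : ℂ) * Complex.I)).comp
          (f := fun s : ℝ => (((2 * Real.pi * s / (4 * g) : ℝ) : ℂ) * Complex.I))
          (by fun_prop)
        simpa only [hbd, Function.comp_def] using this
    have hg' : (4 * g : ℝ) ≠ 0 := by positivity
    rw [mul_div_cancel_right₀ _ hg'] at this
    simpa using this
  have hper : Function.Periodic l (2 * Real.pi * Complex.I) := by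
    intro u
    have h2 : ∀ u, PotentialAt (fun a b => D (polygonMk g (m a)) (polygonMk g (m b)))
        (fun u => l (u + 2 * Real.pi * Complex.I)) u := by
      intro u
      have := (hl (u + 2 * Real.pi * Complex.I)).comp
        (f := fun u => u + 2 * Real.pi * Complex.I) (by fun_prop)
      simpa only [hmper, Function.comp_def] using this
    have h3 := potential_increment_unique hl h2 0 u
    simp only [zero_add, h0] at h3
    linarith
  have hlog : ∀ u : ℂ, l (Complex.log (Complex.exp u)) = l u := by
    intro u
    obtain ⟨n, hn⟩ := Complex.exp_eq_exp_iff_exists_int.1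
      (Complex.exp_log (Complex.exp_ne_zero u))
    rw [hn]
    exact hper.int_mul n u
  -- The interior of the polygon as a subset of the plane; the value `0` elsewhere is irrelevant.
  let r : PolygonSurface g → ℂ := fun y => ((interiorPoint g y).map Subtype.val).getD 0
  have hr : ∀ z : Metric.closedBall (0 : ℂ) 1, ‖(z : ℂ)‖ < 1 → r (polygonMk g z) = z :=
    fun z hz => by simp [r, interiorPoint_mk hz]
  refine ⟨fun y => l (Complex.log (r y)), ?_⟩
  rw [eventually_nhdsWithin_iff]
  refine nhds_polygonMk_le (by simp) ?_
  rw [mem_map]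
  have hO : IsOpen {w : Metric.closedBall (0 : ℂ) 1 | ‖(w : ℂ)‖ < 1} :=
    isOpen_lt (by fun_prop) continuous_const
  filter_upwards [hO.mem_nhds (by simp : ‖(0 : ℂ)‖ < 1)] with z hz hzo
  have hz' : ‖(z : ℂ)‖ < 1 := hz
  have hz0 : (z : ℂ) ≠ 0 := by
    intro h
    exact hzo (congrArg (polygonMk g) (Subtype.ext h))
  refine nhds_polygonMk_le hz' ?_
  rw [mem_map]
  have hure : (Complex.log z).re < 0 := by
    rw [Complex.log_re]
    exact Real.log_neg (norm_pos_iff.2 hz0) hz'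
  have hue : Complex.exp (Complex.log z) = z := Complex.exp_log hz0
  have hmu : m (Complex.log z) = z := Subtype.ext ((hmexp _ hure.le).trans hue)
  have hnear : ∀ᶠ w : ℂ in 𝓝 (z : ℂ), ∃ v : ℂ, Complex.exp v = w ∧ v.re < 0 ∧
      D (polygonMk g z) (polygonMk g (m v)) = l v - l (Complex.log z) := by
    have h1 := Complex.isOpenMap_exp.nhds_le (Complex.log z)
    rw [hue] at h1
    refine h1 ?_
    rw [mem_map]
    filter_upwards [hl (Complex.log z),
      Complex.continuous_re.continuousAt.eventually (gt_mem_nhds hure)] with v h2 h3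
    rw [hmu] at h2
    exact ⟨v, rfl, h3, h2⟩
  filter_upwards [continuous_subtype_val.continuousAt.eventually hnear, hO.mem_nhds hz']
    with w ⟨v, hvw, hv, h⟩ hw
  have hmv : m v = w := Subtype.ext ((hmexp v hv.le).trans hvw)
  rw [hmv] at h
  change D (polygonMk g z) (polygonMk g w) = l (Complex.log (r (polygonMk g w))) -
    l (Complex.log (r (polygonMk g z)))
  rw [hr w hw, hr z hz', h, ← hvw, hlog]

end Polygon

/-! ### The classes of the closed surface -/

section Genus
variable {g : ℕ}

/-- The trapezoidal bump with support `[-3/2, 3/2]` and value `1` on `[-1/2, 1/2]`. -/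
def trapezoid (x : ℝ) : ℝ := max 0 (min 1 (3 / 2 - |x|))

/-- A continuous function on the disc that is the trapezoidal bump around the boundary point with
parameter `m` on the boundary. -/
def discBump (g : ℕ) (m : ℝ) (z : ℂ) : ℝ :=
  trapezoid (Real.arccos (z * (starRingEnd ℂ) (boundaryPoint g m)).re * (4 * g) / (2 * Real.pi))

theorem continuous_discBump (g : ℕ) (m : ℝ) : Continuous (discBump g m) := by
  unfold discBump trapezoid
  have := Complex.continuous_re
  have := Real.continuous_arccos
  fun_prop

theorem trapezoid_eq_zero {x : ℝ} (h : 3 / 2 ≤ |x|) : trapezoid x = 0 :=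
  max_eq_left ((min_le_right _ _).trans (by linarith))

theorem trapezoid_eq_one {x : ℝ} (h : |x| ≤ 1 / 2) : trapezoid x = 1 := by
  unfold trapezoid
  rw [min_eq_left (by linarith), max_eq_right zero_le_one]

theorem trapezoid_eq_of_mem {x : ℝ} (h : |x| ∈ Set.Icc (1 / 2 : ℝ) (3 / 2)) :
    trapezoid x = 3 / 2 - |x| := by
  unfold trapezoid
  rw [min_eq_right (by linarith [h.1]), max_eq_right (by linarith [h.2])]

/-- For `z` and `w` on the unit circle `arccos (re (z * conj w))` is the angle between them. The
hypotheses keep the bump away from the parameters `0` and `4 g`, where the distance on the circle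
is not the difference of the parameters. -/
theorem discBump_boundaryPoint (hg : 0 < g) {m s : ℝ} (hm : m ∈ Set.Icc (3 / 2 : ℝ) (4 * g - 3 / 2))
    (hs : s ∈ Set.Icc (0 : ℝ) (4 * g)) :
    discBump g m (boundaryPoint g s) = trapezoid (s - m) := by
  have hg' : (1 : ℝ) ≤ g := by exact_mod_cast hg
  have hpi := Real.pi_pos
  set θ : ℝ := 2 * Real.pi * |s - m| / (4 * g) with hθ
  have hθ0 : 0 ≤ θ := by positivity
  have hre : (boundaryPoint g s * (starRingEnd ℂ) (boundaryPoint g m) : ℂ).re = Real.cos θ := by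
    have e : θ = |2 * Real.pi * s / (4 * g) - 2 * Real.pi * m / (4 * g)| := by
      rw [hθ, ← sub_div, ← mul_sub, abs_div, abs_mul, abs_of_pos (by positivity : 0 < 2 * Real.pi),
        abs_of_pos (by positivity : (0 : ℝ) < 4 * g)]
    rw [e, Real.cos_abs]
    change (Complex.exp _ * (starRingEnd ℂ) (Complex.exp _)).re = _
    rw [← Complex.exp_conj, ← Complex.exp_add, map_mul, Complex.conj_ofReal, Complex.conj_I,
      mul_neg, ← sub_eq_add_neg, ← sub_mul, ← Complex.ofReal_sub, Complex.exp_ofReal_mul_I_re]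
  unfold discBump
  rw [hre]
  rcases le_total |s - m| (2 * g) with h | h
  · have h1 : θ ≤ Real.pi := by
      rw [hθ, div_le_iff₀ (by positivity)]
      nlinarith
    rw [Real.arccos_cos hθ0 h1]
    have e : θ * (4 * g) / (2 * Real.pi) = |s - m| := by
      rw [hθ]
      field_simp
    rw [e]
    unfold trapezoid
    rw [abs_abs]
  · have hle : |s - m| ≤ 4 * g - 3 / 2 :=
      abs_le.2 ⟨by linarith [hs.1, hm.2], by linarith [hs.2, hm.1]⟩
    have h1 : Real.pi ≤ θ := by
      rw [hθ, le_div_iff₀ (by positivity)]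
      nlinarith
    have h2 : θ ≤ 2 * Real.pi := by
      rw [hθ, div_le_iff₀ (by positivity)]
      nlinarith
    have h3 : Real.cos θ = Real.cos (2 * Real.pi - θ) := (Real.cos_two_pi_sub θ).symm
    rw [h3, Real.arccos_cos (by linarith) (by linarith)]
    have e : (2 * Real.pi - θ) * (4 * g) / (2 * Real.pi) = 4 * g - |s - m| := by
      rw [hθ]
      field_simp
    rw [e, trapezoid_eq_zero, trapezoid_eq_zero]
    · linarith
    · rw [abs_of_nonneg] <;> linarith

/-- The parameter of the middle of the second of three consecutive sides of the polygon, the first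
and the third of which are glued. -/
def midParam (j : Fin g × Fin 2) : ℝ := 4 * (j.1 : ℕ) + (j.2 : ℕ) + 3 / 2

theorem cast_add_one_le (i : Fin g) : ((i : ℕ) : ℝ) + 1 ≤ g := by exact_mod_cast i.2

theorem midParam_mem (j : Fin g × Fin 2) :
    midParam j ∈ Set.Icc (3 / 2 : ℝ) (4 * g - 3 / 2) := by
  obtain ⟨i, ε⟩ := j
  have h1 := cast_add_one_le i
  have h0 : (0 : ℝ) ≤ ((i : ℕ) : ℝ) := by positivity
  unfold midParam
  fin_cases ε <;> constructor <;> simp <;> linarith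

/-- The circle valued function on the polygon whose argument is a full turn times the bump. -/
def discPhase (j : Fin g × Fin 2) (z : ℂ) : ℂ :=
  Complex.exp ((2 * Real.pi * discBump g (midParam j) z : ℝ) * Complex.I)

theorem continuous_discPhase (j : Fin g × Fin 2) : Continuous (discPhase j) := by
  have := continuous_discBump g (midParam j)
  unfold discPhase
  fun_prop

theorem discPhase_eq {j : Fin g × Fin 2} {z w : ℂ} {n : ℤ}
    (h : discBump g (midParam j) z = discBump g (midParam j) w + n) :
    discPhase j z = discPhase j w := by
  unfold discPhase
  rw [Complex.exp_eq_exp_iff_exists_int]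
  refine ⟨n, ?_⟩
  rw [h]
  push_cast
  ring

theorem discPhase_boundaryPoint_eq {j : Fin g × Fin 2} {s s' : ℝ} {n : ℤ}
    (hs : s ∈ Set.Icc (0 : ℝ) (4 * g)) (hs' : s' ∈ Set.Icc (0 : ℝ) (4 * g))
    (h : trapezoid (s - midParam j) = trapezoid (s' - midParam j) + n) :
    discPhase j (boundaryPoint g s) = discPhase j (boundaryPoint g s') := by
  have hg : 0 < g := j.1.pos
  refine discPhase_eq (n := n) ?_
  rw [discBump_boundaryPoint hg (midParam_mem j) hs, discBump_boundaryPoint hg (midParam_mem j) hs',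
    h]

theorem trapezoid_sub_midParam_eq_zero {i k : Fin g} (hik : i ≠ k) (ε : Fin 2) {x : ℝ}
    (hx : x ∈ Set.Icc (0 : ℝ) 4) : trapezoid (4 * (k : ℕ) + x - midParam (i, ε)) = 0 := by
  apply trapezoid_eq_zero
  unfold midParam
  have hε : ((ε : ℕ) : ℝ) ∈ Set.Icc (0 : ℝ) 1 := by
    fin_cases ε <;> simp
  rcases lt_or_gt_of_ne hik with h | h
  · have : ((i : ℕ) : ℝ) + 1 ≤ (k : ℕ) := by exact_mod_cast h
    refine le_abs.2 (Or.inl ?_)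
    dsimp only
    linarith [hx.1, hε.2]
  · have : ((k : ℕ) : ℝ) + 1 ≤ (i : ℕ) := by exact_mod_cast h
    refine le_abs.2 (Or.inr ?_)
    dsimp only
    linarith [hx.2, hε.1]

/-- The values of each bump at glued boundary points are equal or differ by `1`. -/
theorem discPhase_gluing (j : Fin g × Fin 2) {z w : Metric.closedBall (0 : ℂ) 1}
    (h : SideGluing g z w) : discPhase j z = discPhase j w := by
  obtain ⟨i, ε⟩ := j
  have hmem : ∀ (k : Fin g) (x : ℝ), x ∈ Set.Icc (0 : ℝ) 4 →
      4 * (k : ℕ) + x ∈ Set.Icc (0 : ℝ) (4 * g) := fun k x hx => by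
    have h1 := cast_add_one_le k
    have h0 : (0 : ℝ) ≤ ((k : ℕ) : ℝ) := by positivity
    exact ⟨by linarith [hx.1], by linarith [hx.2]⟩
  have key : ∀ (k : Fin g) (x y : ℝ) (n : ℤ), x ∈ Set.Icc (0 : ℝ) 4 → y ∈ Set.Icc (0 : ℝ) 4 →
      (i = k → trapezoid (x - (ε : ℕ) - 3 / 2) = trapezoid (y - (ε : ℕ) - 3 / 2) + n) →
      discPhase (i, ε) (boundaryPoint g (4 * (k : ℕ) + x)) =
        discPhase (i, ε) (boundaryPoint g (4 * (k : ℕ) + y)) := by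
    intro k x y n hx hy h
    by_cases hik : i = k
    · refine discPhase_boundaryPoint_eq (n := n) (hmem k x hx) (hmem k y hy) ?_
      subst hik
      convert h rfl using 2
      · unfold midParam
        ring
      · congr 1
        unfold midParam
        ring
    · refine discPhase_boundaryPoint_eq (n := 0) (hmem k x hx) (hmem k y hy) ?_
      rw [trapezoid_sub_midParam_eq_zero hik ε hx, trapezoid_sub_midParam_eq_zero hik ε hy]
      simp
  cases h with
  | a k t ht =>
    obtain ⟨ht0, ht1⟩ := ht
    have h1 : |t - 3 / 2| = 3 / 2 - t := by rw [abs_of_nonpos] <;> linarith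
    have h2 : |3 - t - 3 / 2| = 3 / 2 - t := by rw [abs_of_nonneg] <;> linarith
    have h3 : |t - 1 - 3 / 2| = 5 / 2 - t := by rw [abs_of_nonpos] <;> linarith
    rw [add_sub_assoc]
    refine key k t (3 - t) (-(ε : ℕ)) ⟨by linarith, by linarith⟩ ⟨by linarith, by linarith⟩
      fun _ => ?_
    fin_cases ε
    · have e1 := trapezoid_eq_of_mem (x := t - 3 / 2) ⟨by linarith, by linarith⟩
      have e2 := trapezoid_eq_of_mem (x := 3 - t - 3 / 2) ⟨by linarith, by linarith⟩
      simp [e1, e2, h1, h2]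
    · have e1 := trapezoid_eq_zero (x := t - 1 - 3 / 2) (by linarith)
      have e2 := trapezoid_eq_one (x := 3 - t - 1 - 3 / 2)
        (abs_le.2 ⟨by linarith, by linarith⟩)
      simp [e1, e2]
  | b k t ht =>
    obtain ⟨ht0, ht1⟩ := ht
    have h1 : |1 + t - 1 - 3 / 2| = 3 / 2 - t := by rw [abs_of_nonpos] <;> linarith
    have h2 : |4 - t - 1 - 3 / 2| = 3 / 2 - t := by rw [abs_of_nonneg] <;> linarith
    have h3 : |4 - t - 3 / 2| = 5 / 2 - t := by rw [abs_of_nonneg] <;> linarith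
    rw [add_sub_assoc, add_assoc]
    refine key k (1 + t) (4 - t) (1 - (ε : ℕ)) ⟨by linarith, by linarith⟩
      ⟨by linarith, by linarith⟩ fun _ => ?_
    fin_cases ε
    · have e1 := trapezoid_eq_one (x := 1 + t - 3 / 2) (abs_le.2 ⟨by linarith, by linarith⟩)
      have e2 := trapezoid_eq_zero (x := 4 - t - 3 / 2) (by linarith)
      simp [e1, e2]
    · have e1 := trapezoid_eq_of_mem (x := 1 + t - 1 - 3 / 2) ⟨by linarith, by linarith⟩
      have e2 := trapezoid_eq_of_mem (x := 4 - t - 1 - 3 / 2) ⟨by linarith, by linarith⟩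
      simp only [Nat.cast_one, e1, e2, h1, h2]
      simp

/-- The circle valued function on the surface defined by `discPhase`. -/
def surfacePhase (j : Fin g × Fin 2) : PolygonSurface g → ℂ :=
  Quot.lift (fun z => discPhase j z) fun _ _ h => discPhase_gluing j h

theorem continuous_surfacePhase (j : Fin g × Fin 2) : Continuous (surfacePhase j) :=
  continuous_quot_lift _ ((continuous_discPhase j).comp continuous_subtype_val)

theorem surfacePhase_ne_zero (j : Fin g × Fin 2) (x : PolygonSurface g) : surfacePhase j x ≠ 0 := by
  induction x using Quot.ind with
  | mk z => exact Complex.exp_ne_zero _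

theorem cocycleAt_surfacePhase (j : Fin g × Fin 2) (x : PolygonSurface g) :
    CocycleAt (argCocycle (surfacePhase j)) x :=
  cocycleAt_argCocycle (.of_forall fun _ => (continuous_surfacePhase j).continuousAt)
    (surfacePhase_ne_zero j x)

theorem potentialAt_surfacePhase (j : Fin g × Fin 2) (z : Metric.closedBall (0 : ℂ) 1) :
    PotentialAt (fun a b => argCocycle (surfacePhase j) (polygonMk g a) (polygonMk g b))
      (fun a => 2 * Real.pi * discBump g (midParam j) a) z := by
  have hc : Continuous fun a : Metric.closedBall (0 : ℂ) 1 =>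
      ((2 * Real.pi * discBump g (midParam j) a : ℝ) * Complex.I : ℂ) := by
    have := continuous_discBump g (midParam j)
    fun_prop
  filter_upwards [hc.continuousAt.eventually (eventually_arg_exp_div _)] with w hw
  refine hw.trans ?_
  simp

/-- The `2 g` angle cocycles of the surface of genus `g` are independent modulo potentials: along
the loop given by a side of the polygon exactly one of them has a nonzero integral. -/
theorem surfacePhase_independent {a : Fin g × Fin 2 → ℝ} {h : PolygonSurface g → ℝ}
    (hh : ∀ x, PotentialAt (∑ j, a j • argCocycle (surfacePhase j)) h x) : a = 0 := by
  ext ⟨k, δ⟩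
  have hg : 0 < g := k.pos
  have hk := cast_add_one_le k
  have hk0 : (0 : ℝ) ≤ ((k : ℕ) : ℝ) := by positivity
  have hδ : ((δ : ℕ) : ℝ) ∈ Set.Icc (0 : ℝ) 1 := by
    fin_cases δ <;> simp
  let γ : unitInterval → Metric.closedBall (0 : ℂ) 1 := fun t =>
    boundaryPoint g (4 * (k : ℕ) + ((δ : ℕ) + t))
  have hγ : Continuous γ := (continuous_boundaryPoint g).comp (by fun_prop)
  -- The gluings identify the vertices `4 k`, …, `4 k + 3`.
  have hclosed : polygonMk g (γ 1) = polygonMk g (γ 0) := by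
    have a0 := polygonMk_a k 0 (by simp)
    have a1 := polygonMk_a k 1 (by simp)
    have b0 := polygonMk_b k 0 (by simp)
    have b1 := polygonMk_b k 1 (by simp)
    fin_cases δ <;> simp [γ] <;> ring_nf at a0 a1 b0 b1 ⊢
    · rw [a0, ← b1, a1]
    · rw [a1]
  have h1 : ∀ t, PotentialAt (fun s t => (∑ j, a j • argCocycle (surfacePhase j))
      (polygonMk g (γ s)) (polygonMk g (γ t))) (fun t => h (polygonMk g (γ t))) t := fun t =>
    (hh (polygonMk g (γ t))).comp (f := fun t => polygonMk g (γ t))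
      ((continuous_polygonMk g).comp hγ).continuousAt
  have h2 : ∀ t, PotentialAt (fun s t => (∑ j, a j • argCocycle (surfacePhase j))
      (polygonMk g (γ s)) (polygonMk g (γ t)))
      (∑ j, a j • fun t => 2 * Real.pi * discBump g (midParam j) (γ t)) t := fun t => by
    have := PotentialAt.sum (x := t) Finset.univ fun j _ =>
      ((potentialAt_surfacePhase j (γ t)).comp hγ.continuousAt).smul (a j)
    convert this using 1
    · ext u v
      simp
    · rfl
  have h3 := potential_increment_unique h1 h2 0 1
  simp only [hclosed, sub_self] at h3
  have hs : ∀ t : unitInterval, (4 * (k : ℕ) + ((δ : ℕ) + (t : ℝ))) ∈ Set.Icc (0 : ℝ) (4 * g) :=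
    fun t => ⟨by linarith [t.2.1, hδ.1], by linarith [t.2.2, hδ.2]⟩
  -- The bump `(k, δ)` increases from `0` to `1` on the side; every other bump is `0` at both ends or
  -- `1` at both ends.
  have h4 : ∀ j, discBump g (midParam j) (γ 1) - discBump g (midParam j) (γ 0) =
      if j = (k, δ) then 1 else 0 := by
    rintro ⟨i, ε⟩
    simp only [γ]
    rw [discBump_boundaryPoint hg (midParam_mem _) (hs 1),
      discBump_boundaryPoint hg (midParam_mem _) (hs 0)]
    by_cases hik : i = k
    · subst hik
      simp only [midParam]
      fin_cases ε <;> fin_cases δ <;> simp <;> norm_num [trapezoid] <;> ring_nf <;> norm_num [abs_of_pos, abs_of_neg]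
    · rw [trapezoid_sub_midParam_eq_zero hik, trapezoid_sub_midParam_eq_zero hik,
        if_neg (fun h => hik (congrArg Prod.fst h)), sub_zero]
      · exact ⟨add_nonneg hδ.1 (0 : unitInterval).2.1,
          by linarith [hδ.2, (0 : unitInterval).2.2]⟩
      · exact ⟨add_nonneg hδ.1 (1 : unitInterval).2.1,
          by linarith [hδ.2, (1 : unitInterval).2.2]⟩
  simp only [Finset.sum_apply, Pi.smul_apply, ← Finset.sum_sub_distrib, smul_eq_mul, ← mul_sub, h4]
    at h3
  simp at h3
  have := Real.pi_ne_zero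
  simpa [this] using h3

end Genus

/-! ### Complements of finite sets -/

/-- Functions of pairs in the complement extend to the whole space, by `0`. -/
theorem exists_restrict_eq {X : Type*} {s : Set X} (D : {x : X // x ∉ s} → {x : X // x ∉ s} → ℝ) :
    ∃ E : X → X → ℝ, (fun a b : {x : X // x ∉ s} => E a b) = D := by
  classical
  refine ⟨fun a b => if h : a ∉ s ∧ b ∉ s then D ⟨a, h.1⟩ ⟨b, h.2⟩ else 0, ?_⟩
  ext a b
  exact dif_pos ⟨a.2, b.2⟩

theorem exists_restrict_eq_fun {X : Type*} {s : Set X} (h : {x : X // x ∉ s} → ℝ) :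
    ∃ k : X → ℝ, (fun a : {x : X // x ∉ s} => k a) = h := by
  classical
  refine ⟨fun a => if h' : a ∉ s then h ⟨a, h'⟩ else 0, ?_⟩
  ext a
  exact dif_pos a.2

section Complement
variable {X : Type} [TopologicalSpace X] {s : Set X} {D E : X → X → ℝ} {k : X → ℝ}

/-- The inclusion of the complement of `s`. -/
def complInclusion (s : Set X) : C({x : X // x ∉ s}, X) := ⟨Subtype.val, continuous_subtype_val⟩

theorem eventually_compl_iff (hs : IsClosed s) {P : X → Prop} (y : {x : X // x ∉ s}) :
    (∀ᶠ z : {x : X // x ∉ s} in 𝓝 y, P z) ↔ ∀ᶠ z in 𝓝 (y : X), P z := by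
  have h : IsOpenEmbedding (Subtype.val : {x : X // x ∉ s} → X) :=
    hs.isOpen_compl.isOpenEmbedding_subtypeVal
  rw [← h.map_nhds_eq y, eventually_map]

theorem potentialAt_compl_iff (hs : IsClosed s) (y : {x : X // x ∉ s}) :
    PotentialAt (fun a b : {x : X // x ∉ s} => D a b) (fun a => k a) y ↔ PotentialAt D k y :=
  eventually_compl_iff hs (P := fun z => D y z = k z - k y) y

theorem cocycleAt_compl_iff (hs : IsClosed s) (y : {x : X // x ∉ s}) :
    CocycleAt (fun a b : {x : X // x ∉ s} => D a b) y ↔ CocycleAt D y := by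
  refine Iff.trans ?_ (eventually_compl_iff hs
    (P := fun z => ∀ᶠ w in 𝓝 z, D y w = D y z + D z w) y)
  exact eventually_congr (.of_forall fun z =>
    eventually_compl_iff hs (P := fun w => D y w = D y z + D z w) z)

theorem eventually_notMem_of_finite [T1Space X] (hs : s.Finite) (x : X) : ∀ᶠ y in 𝓝[≠] x, y ∉ s := by
  rw [eventually_nhdsWithin_iff]
  filter_upwards [(hs.subset (Set.sdiff_subset (t := {x}))).isClosed.isOpen_compl.mem_nhds
    (fun h => h.2 rfl)] with y hy hyx hys
  exact hy ⟨hys, hyx⟩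

/-- A cocycle without residues on the complement of a finite set extends, up to a potential. -/
theorem exists_extension_of_finite [T1Space X] (hs : s.Finite) (hD : ∀ y ∉ s, CocycleAt D y)
    (hR : ∀ y ∈ s, ResidueFree D y) :
    ∃ (D' : X → X → ℝ) (k : X → ℝ), (∀ y, CocycleAt D' y) ∧ ∀ y ∉ s, PotentialAt (D' - D) k y := by
  induction s, hs using Set.Finite.induction_on generalizing D with
  | empty => exact ⟨D, 0, fun y => hD y (by simp), fun y _ => .of_forall fun z => by simp⟩
  | @insert a s ha hs ih =>
    obtain ⟨D₁, k₁, h1, h2⟩ := (hR a (Set.mem_insert _ _)).exists_extension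
    have h3 : ∀ y ≠ a, ∀ᶠ z in 𝓝 y, PotentialAt (D₁ - D) k₁ z := fun y hy => by
      filter_upwards [isOpen_ne.mem_nhds hy] with z hz using h2 z hz
    obtain ⟨D', k, h4, h5⟩ := ih (D := D₁) (fun y hy => by
        by_cases hya : y = a
        · rwa [hya]
        · exact (hD y (by simp [hya, hy])).of_sub (h3 y hya))
      (fun y hy => by
        have hya : y ≠ a := fun h => ha (h ▸ hy)
        have := (hR y (Set.mem_insert_of_mem _ hy)).add
          ⟨k₁, nhdsWithin_le_nhds (h3 y hya)⟩
        rwa [add_sub_cancel] at this)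
    refine ⟨D', k + k₁, h4, fun y hy => ?_⟩
    have := (h5 y fun h => hy (Set.mem_insert_of_mem _ h)).add
      (h2 y fun h => hy (h ▸ Set.mem_insert _ _))
    rwa [sub_add_sub_cancel] at this

/-- If `E` extends over `s` up to a potential, then its integral factors through the homology of
the whole space. -/
theorem IsPeriod.exists_factor (hs : IsClosed s) {w : Module.Dual ℝ (H ℝ 1 {x : X // x ∉ s})}
    (hE : IsPeriod (fun a b : {x : X // x ∉ s} => E a b) w) (hD : ∀ y, CocycleAt D y)
    (hk : ∀ y ∉ s, PotentialAt (D - E) k y) :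
    ∃ U : Module.Dual ℝ (H ℝ 1 X), w = U ∘ₗ Hmap ℝ 1 (complInclusion s) := by
  obtain ⟨U, hU⟩ := exists_isPeriod hD
  refine ⟨U, ?_⟩
  have h1 := (hU.comp (complInclusion s)).sub hE
  exact (sub_eq_zero.1 (h1.eq_zero (h := fun a => k a)
    fun y => (potentialAt_compl_iff hs y).2 (hk y y.2))).symm

theorem compl_locallyPathConnectedSpace [LocallyPathConnectedSpace X] (hs : IsClosed s) :
    LocallyPathConnectedSpace {x : X // x ∉ s} :=
  hs.isOpen_compl.locallyPathConnectedSpace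

theorem exists_contractible_nhds (hX : ∀ x : X, ∃ ψ, IsDiscChart ψ x) (x : X) :
    ∃ U ∈ 𝓝 x, ContractibleSpace U := by
  obtain ⟨ψ, hψ⟩ := hX x
  exact ⟨ψ.source, hψ.source_mem_nhds, hψ.contractible⟩

theorem exists_contractible_nhds_compl (hX : ∀ x : X, ∃ ψ, IsDiscChart ψ x) (hs : IsClosed s)
    (y : {x : X // x ∉ s}) : ∃ U ∈ 𝓝 y, ContractibleSpace U := by
  obtain ⟨ψ, hψ⟩ := hX y
  obtain ⟨ψ', hψ', hsub, -⟩ := exists_discChart_subset hψ.mem_source hψ.apply_center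
    (hs.isOpen_compl.mem_nhds y.2)
  refine ⟨Subtype.val ⁻¹' ψ'.source,
    continuous_subtype_val.continuousAt.preimage_mem_nhds hψ'.source_mem_nhds, ?_⟩
  have := hψ'.contractible
  have hval : IsEmbedding (Subtype.val : {x : X // x ∉ s} → X) := IsEmbedding.subtypeVal
  have e := hval.homeomorphImage (Subtype.val ⁻¹' ψ'.source)
  have himage : (Subtype.val : {x : X // x ∉ s} → X) '' (Subtype.val ⁻¹' ψ'.source) =
      ψ'.source := by
    rw [Set.image_preimage_eq_iff]
    exact fun z hz => ⟨⟨z, (hsub hz).1⟩, rfl⟩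
  rw [himage] at e
  exact e.contractibleSpace

/-- A homeomorphism that is isotopic to the identity on the whole surface and fixes a finite set
acts trivially on the classes of the complement that vanish in the whole surface. -/
theorem Hmap_eq_self_of_mem_ker [T2Space X] [LocallyPathConnectedSpace X]
    (hX : ∀ x : X, ∃ ψ, IsDiscChart ψ x) {ω : X → X → X → ℝ} (hω : IsOrientation ω)
    (hs : s.Finite) {F : unitInterval → (X ≃ₜ X)}
    (hF : Continuous fun a : unitInterval × X => F a.1 a.2) (hF0 : F 0 = 1)
    (hFs : ∀ x ∈ s, F 1 x = x) {r : C({x : X // x ∉ s}, {x : X // x ∉ s})}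
    (hr : ∀ y, (r y : X) = F 1 y) {v : H ℝ 1 {x : X // x ∉ s}}
    (hv : Hmap ℝ 1 (complInclusion s) v = 0) : Hmap ℝ 1 r v = v := by
  have hsc := hs.isClosed
  have := compl_locallyPathConnectedSpace hsc
  rw [← sub_eq_zero, ← Module.forall_dual_apply_eq_zero_iff ℝ]
  intro u
  obtain ⟨D, hD, hu⟩ := exists_cocycle_isPeriod (exists_contractible_nhds_compl hX hsc) u
  obtain ⟨E, rfl⟩ := exists_restrict_eq D
  have hE : ∀ y ∉ s, CocycleAt E y := fun y hy => (cocycleAt_compl_iff hsc ⟨y, hy⟩).1 (hD _)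
  have hFy : ∀ y ∉ s, F 1 y ∉ s := fun y hy => by
    have := (r ⟨y, hy⟩).2
    rwa [hr] at this
  obtain ⟨D', k, h1, h2⟩ := exists_extension_of_finite hs
    (D := (fun a b => E (F 1 a) (F 1 b)) - E)
    (fun y hy => ((hE _ (hFy y hy)).comp
      (.of_forall fun _ => (F 1).continuous.continuousAt)).sub (hE y hy))
    (fun y hy => hω.residueFree_pullback_sub hF hF0 (hFs y hy) (by
      filter_upwards [eventually_notMem_of_finite hs y] with z hz using hE z hz))
  have h3 := (hu.comp r).sub hu
  have h4 : ((fun a b => E (r a) (r b)) - fun a b : {x : X // x ∉ s} => E a b) =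
      fun a b : {x : X // x ∉ s} => ((fun a b => E (F 1 a) (F 1 b)) - E) a b := by
    ext a b
    simp [hr]
  rw [h4] at h3
  obtain ⟨U, hU⟩ := h3.exists_factor hsc h1 h2
  have h5 := LinearMap.congr_fun hU v
  rw [LinearMap.comp_apply, hv, map_zero] at h5
  rw [map_sub]
  exact h5

/-- The integrals of the cocycles with poles at `q` and at one of the points `x i` are independent
modulo functionals that factor through the homology of the whole surface. -/
theorem exists_dual_independent_of_poles [T2Space X] [ConnectedSpace X]
    [LocallyPathConnectedSpace X]
    (hX : ∀ x : X, ∃ ψ, IsDiscChart ψ x) (hR : ∀ x : X, ResidueTheorem x) {ι : Type*} [Fintype ι]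
    {q : X} {x : ι → X} (hx : Function.Injective x) (hq : ∀ i, x i ≠ q) (hs : s.Finite)
    (hqs : q ∈ s) (hxs : ∀ i, x i ∈ s) :
    ∃ w : ι → Module.Dual ℝ (H ℝ 1 {x : X // x ∉ s}), ∀ (a : ι → ℝ) (U : Module.Dual ℝ (H ℝ 1 X)),
      ∑ i, a i • w i = U ∘ₗ Hmap ℝ 1 (complInclusion s) → a = 0 := by
  classical
  have hsc := hs.isClosed
  have := compl_locallyPathConnectedSpace hsc
  obtain ⟨ψq, hψq⟩ := hX q
  choose u hu using fun i => exists_hasPole hX hψq (x i) (hq i)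
  have huc : ∀ i, ∀ y ∉ s, CocycleAt (u i) y := fun i y hy =>
    (hu i).cocycleAt y (fun h => hy (h ▸ hqs)) (fun h => hy (h ▸ hxs i))
  choose w hw using fun i => exists_isPeriod
    (D := fun a b : {x : X // x ∉ s} => u i a b) fun y => (cocycleAt_compl_iff hsc y).2 (huc i y y.2)
  refine ⟨w, fun a U hU => ?_⟩
  obtain ⟨D, hD, hDU⟩ := exists_cocycle_isPeriod (exists_contractible_nhds hX) U
  have h1 := (IsPeriod.sum Finset.univ fun i _ => (hw i).smul (a i)).sub
    (hDU.comp (complInclusion s))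
  rw [hU, sub_self] at h1
  obtain ⟨h, hh⟩ := h1.exists_potential fun y =>
    (CocycleAt.sum Finset.univ fun i _ =>
      ((cocycleAt_compl_iff hsc y).2 (huc i y y.2)).smul (a i)).sub
      ((cocycleAt_compl_iff hsc y).2 (hD y))
  obtain ⟨k, rfl⟩ := exists_restrict_eq_fun h
  have h2 : ∀ y ∉ s, PotentialAt (∑ i, a i • u i - D) k y := fun y hy => by
    rw [← potentialAt_compl_iff hsc ⟨y, hy⟩]
    convert hh ⟨y, hy⟩ using 1
    ext a b
    simp
  -- `D` and the cocycles without pole at `x j` have no residue there, so neither has `a j • u j`.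
  ext j
  by_contra hj
  have h3 : ResidueFree (∑ i, a i • u i - D) (x j) :=
    ⟨k, by filter_upwards [eventually_notMem_of_finite hs (x j)] with y hy using h2 y hy⟩
  obtain ⟨ψ, hψ⟩ := hX (x j)
  have h4 := h3.add (hψ.residueFree_of_cocycleAt (.of_forall hD))
  rw [sub_add_cancel] at h4
  have h5 : ResidueFree (∑ i ∈ Finset.univ.erase j, a i • u i) (x j) :=
    ResidueFree.sum _ fun i hi => (residueFree_of_ne (s := {q, x i}) (by simp) hψ
      (fun z hz => (hu i).cocycleAt z (by aesop) (by aesop))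
      (by simpa using ⟨hq j, fun h => Finset.ne_of_mem_erase hi (hx h).symm⟩)).smul (a i)
  have h6 := (h4.sub h5).smul (a j)⁻¹
  rw [← Finset.add_sum_erase _ _ (Finset.mem_univ j), add_sub_cancel_right,
    inv_smul_smul₀ hj] at h6
  exact (hu j).not_residueFree hψq (hq j) (hR q) h6

/-- A potential of a cocycle on a punctured disc extends over the puncture. -/
theorem IsDiscChart.exists_value {ψ : OpenPartialHomeomorph X ℂ} {x : X} (hψ : IsDiscChart ψ x)
    (hD : ∀ y, CocycleAt D y) (hk : ∀ᶠ y in 𝓝[≠] x, PotentialAt D k y) :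
    ∃ c : ℝ, ∀ᶠ y in 𝓝[≠] x, D x y = k y - c := by
  rw [eventually_nhdsWithin_iff] at hk
  obtain ⟨ψ', hψ', hsub, -⟩ := exists_discChart_subset hψ.mem_source hψ.apply_center hk
  obtain ⟨l, hl⟩ := hψ'.exists_potential fun y _ => hD y
  have hconn : IsPreconnected (ψ'.symm '' {0}ᶜ) :=
    (isConnected_compl_singleton_of_one_lt_rank (E := ℂ) (by simp) 0).isPreconnected.image _
      hψ'.continuous_symm.continuousOn
  have hmem : ∀ y ∈ ψ'.source, y ≠ x → y ∈ ψ'.symm '' {0}ᶜ := fun y hy hyx =>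
    ⟨ψ' y, hψ'.apply_ne_zero hy hyx, ψ'.left_inv hy⟩
  have hconst : ∀ y ∈ ψ'.symm '' {0}ᶜ, k y - l y = k (ψ'.symm 1) - l (ψ'.symm 1) := fun y hy => by
    refine potential_unique hconn ?_ hy ⟨1, by simp, rfl⟩
    rintro _ ⟨z, hz, rfl⟩
    have h1 := hψ'.symm_mem z
    exact nhdsWithin_le_nhds (((hsub h1).1 (hψ'.symm_ne hz)).eventually_sub_eq (hl _ h1))
  refine ⟨l x + (k (ψ'.symm 1) - l (ψ'.symm 1)), ?_⟩
  rw [eventually_nhdsWithin_iff]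
  filter_upwards [hl x hψ'.mem_source, hψ'.source_mem_nhds] with y h1 h2 h3
  rw [h1, ← hconst y (hmem y h2 h3)]
  ring

/-- A cocycle with a potential on the complement of a finite set has a potential. -/
theorem exists_potential_of_compl [T1Space X] (hX : ∀ x : X, ∃ ψ, IsDiscChart ψ x) (hs : s.Finite)
    (hD : ∀ y, CocycleAt D y) (hk : ∀ y ∉ s, PotentialAt D k y) :
    ∃ h : X → ℝ, ∀ y, PotentialAt D h y := by
  classical
  choose ψ hψ using hX
  choose c hc using fun x => (hψ x).exists_value hD (k := k) (by
    filter_upwards [eventually_notMem_of_finite hs x] with y hy using hk y hy)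
  refine ⟨fun y => if y ∈ s then c y else k y, fun y => ?_⟩
  by_cases hy : y ∈ s
  · have h1 := (hc y).and (eventually_notMem_of_finite hs y)
    rw [eventually_nhdsWithin_iff] at h1
    filter_upwards [h1] with z hz
    by_cases hzy : z = y
    · simp [hzy, (hD y).self_eq_zero]
    · rw [if_neg (hz hzy).2, if_pos hy, (hz hzy).1]
  · filter_upwards [hs.isClosed.isOpen_compl.mem_nhds hy, hk y hy] with z h1 h2
    rw [if_neg h1, if_neg hy, h2]

/-- Cocycles of the whole surface that are independent modulo potentials have independent
integrals over the cycles that avoid a finite set. -/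
theorem exists_dual_independent_of_cocycles [T1Space X] [LocallyPathConnectedSpace X]
    (hX : ∀ x : X, ∃ ψ, IsDiscChart ψ x) (hs : s.Finite) {ι : Type*} [Fintype ι]
    {D : ι → X → X → ℝ} (hD : ∀ i y, CocycleAt (D i) y)
    (hind : ∀ (a : ι → ℝ) (h : X → ℝ), (∀ y, PotentialAt (∑ i, a i • D i) h y) → a = 0) :
    ∃ U : ι → Module.Dual ℝ (H ℝ 1 X), ∀ a : ι → ℝ,
      (∑ i, a i • U i) ∘ₗ Hmap ℝ 1 (complInclusion s) = 0 → a = 0 := by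
  have hsc := hs.isClosed
  have := compl_locallyPathConnectedSpace hsc
  choose U hU using fun i => exists_isPeriod (hD i)
  refine ⟨U, fun a ha => ?_⟩
  have hDa : ∀ y, CocycleAt (∑ i, a i • D i) y := fun y =>
    CocycleAt.sum Finset.univ fun i _ => (hD i y).smul (a i)
  have h1 := (IsPeriod.sum Finset.univ fun i _ => (hU i).smul (a i)).comp (complInclusion s)
  rw [ha] at h1
  obtain ⟨h, hh⟩ := h1.exists_potential fun y => (cocycleAt_compl_iff hsc y).2 (hDa y)
  obtain ⟨k, rfl⟩ := exists_restrict_eq_fun h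
  obtain ⟨l, hl⟩ := exists_potential_of_compl hX hs hDa
    fun y hy => (potentialAt_compl_iff hsc ⟨y, hy⟩).1 (hh ⟨y, hy⟩)
  exact hind a l hl

end Complement

/-! ### Dimension count -/

/-- A space is at least as large as a finite independent family of functionals on it. Its dimension
may be infinite. -/
theorem card_le_rank_of_dual_independent {V ι : Type*} [AddCommGroup V] [Module ℝ V] [Fintype ι]
    {w : ι → Module.Dual ℝ V} (hw : ∀ a : ι → ℝ, ∑ i, a i • w i = 0 → a = 0) :
    (Fintype.card ι : Cardinal) ≤ Module.rank ℝ V := by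
  by_cases hV : Module.Finite ℝ V
  · have hli : LinearIndependent ℝ w :=
      Fintype.linearIndependent_iff.2 fun a ha i => congrFun (hw a ha) i
    have := hli.fintype_card_le_finrank
    rw [Subspace.dual_finrank_eq] at this
    rw [← Module.finrank_eq_rank]
    exact_mod_cast this
  · rw [← Module.rank_lt_aleph0_iff, not_lt] at hV
    exact (Cardinal.natCast_lt_aleph0).le.trans hV

/-- If `φ` induces the identity on the range of `f` and on the kernel of `f`, then the dimension of
its fixed space is at least that of either: `φ - 1` maps into the kernel of `f`. -/
theorem max_rank_le_rank_eqLocus {V W : Type} [AddCommGroup V] [Module ℝ V] [AddCommGroup W]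
    [Module ℝ W] {f : V →ₗ[ℝ] W} {φ : V →ₗ[ℝ] V} (hf : f ∘ₗ φ = f)
    (hφ : ∀ v, f v = 0 → φ v = v) {a : ℕ} (ha : (a : Cardinal) ≤ Module.rank ℝ (LinearMap.range f)) :
    max (a : Cardinal) (Module.rank ℝ (LinearMap.ker f)) ≤
      Module.rank ℝ (LinearMap.eqLocus φ LinearMap.id) := by
  have hker : LinearMap.ker f ≤ LinearMap.eqLocus φ LinearMap.id := fun v hv => hφ v hv
  have hK := Submodule.rank_mono hker
  refine max_le ?_ hK
  rcases le_or_gt Cardinal.aleph0 (Module.rank ℝ (LinearMap.ker f)) with hfin | hfin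
  · exact (Cardinal.natCast_lt_aleph0).le.trans (hfin.trans hK)
  · have hrange : LinearMap.range (φ - LinearMap.id) ≤ LinearMap.ker f := by
      rintro _ ⟨v, rfl⟩
      have := LinearMap.congr_fun hf v
      simpa [sub_eq_zero] using this
    have h1 := LinearMap.rank_range_add_rank_ker f
    have h2 := LinearMap.rank_range_add_rank_ker (φ - LinearMap.id)
    rw [← LinearMap.eqLocus_eq_ker_sub] at h2
    have h3 := Submodule.rank_mono hrange
    rw [← Cardinal.add_le_add_iff_of_lt_aleph0 hfin]
    calc (a : Cardinal) + Module.rank ℝ (LinearMap.ker f)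
        ≤ Module.rank ℝ (LinearMap.range f) + Module.rank ℝ (LinearMap.ker f) := by gcongr
      _ = Module.rank ℝ (LinearMap.range (φ - LinearMap.id)) +
          Module.rank ℝ (LinearMap.eqLocus φ LinearMap.id) := by rw [h1, h2]
      _ ≤ Module.rank ℝ (LinearMap.ker f) +
          Module.rank ℝ (LinearMap.eqLocus φ LinearMap.id) := by gcongr
      _ = _ := add_comm _ _

/-! ### The fixed space of a pure braid -/

section Main
variable {S : Type} [TopologicalSpace S] {g : ℕ}

theorem exists_isDiscChart [ChartedSpace (EuclideanSpace ℝ (Fin 2)) S] (x : S) :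
    ∃ ψ, IsDiscChart ψ x := by
  let e : EuclideanSpace ℝ (Fin 2) ≃ₜ ℂ := Complex.orthonormalBasisOneI.repr.symm.toHomeomorph
  let φ := (chartAt (EuclideanSpace ℝ (Fin 2)) x).trans e.toOpenPartialHomeomorph
  have hx : x ∈ φ.source := by
    simp [φ]
  obtain ⟨ψ, hψ, -⟩ := exists_discChart_subset (φ := translateChart φ x) (x := x)
    (by rwa [translateChart_source]) (by rw [translateChart_apply, sub_self]) univ_mem
  exact ⟨ψ, hψ⟩

theorem HasGenus.residueTheorem [T2Space S] [ConnectedSpace S]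
    (hX : ∀ x : S, ∃ ψ, IsDiscChart ψ x) (hg : 0 < g) (hS : HasGenus S g) (x : S) :
    ResidueTheorem x := by
  obtain ⟨e⟩ := hS
  refine ResidueTheorem.forall hX (x := e.symm (polygonMk g
    ⟨0, Metric.mem_closedBall_self zero_le_one⟩)) (fun D hD => ?_) x
  have h := residueTheorem_polygon hg (fun a b => D (e.symm a) (e.symm b)) fun y hy =>
    (hD (e.symm y) fun h => hy (e.symm.injective h)).comp
      (.of_forall fun _ => e.symm.continuous.continuousAt)
  have h' := ResidueFree.comp e (y := e.symm (polygonMk g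
    ⟨0, Metric.mem_closedBall_self zero_le_one⟩)) (by rwa [e.apply_symm_apply])
  simpa only [e.symm_apply_apply] using h'

theorem HasGenus.exists_cocycles (hS : HasGenus S g) :
    ∃ D : Fin g × Fin 2 → S → S → ℝ, (∀ j x, CocycleAt (D j) x) ∧
      ∀ (a : Fin g × Fin 2 → ℝ) (h : S → ℝ), (∀ x, PotentialAt (∑ j, a j • D j) h x) → a = 0 := by
  obtain ⟨e⟩ := hS
  refine ⟨fun j a b => argCocycle (surfacePhase j) (e a) (e b), fun j x =>
    (cocycleAt_surfacePhase j (e x)).comp (.of_forall fun _ => e.continuous.continuousAt),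
    fun a h hh => surfacePhase_independent (h := h ∘ e.symm) fun x => ?_⟩
  have := (hh (e.symm x)).comp e.symm.continuous.continuousAt
  convert this using 1
  ext y z
  simp

theorem restrict_comp_complInclusion {n : ℕ} (p : Fin n → S) (φ : S ≃ₜ S) (h : ∀ i, φ (p i) = p i) :
    (complInclusion (Set.range p)).comp (restrict p φ h) =
      (φ : C(S, S)).comp (complInclusion (Set.range p)) := rfl

theorem Hmap_eq_id_of_isotopy {F : unitInterval → (S ≃ₜ S)}
    (hF : Continuous fun q : unitInterval × S => F q.1 q.2) (hF0 : F 0 = 1) (k : ℕ) :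
    Hmap ℝ k (F 1 : C(S, S)) = LinearMap.id := by
  refine Eq.trans (Eq.symm ?_) (Hmap_id ℝ k S)
  exact Hmap_eq_of_homotopic ℝ k ⟨⟨⟨fun q => F q.1 q.2, hF⟩, fun x => by simp [hF0], fun x => rfl⟩⟩

end Main
end SurfaceBraid

end

open SurfaceBraid

theorem lemma5p3 {S : Type} [TopologicalSpace S] [T2Space S] [CompactSpace S] [ConnectedSpace S]
    [ChartedSpace (EuclideanSpace ℝ (Fin 2)) S] (g n : ℕ) (hg : 2 ≤ g) (hn : 1 ≤ n)
    (hS : SurfaceBraid.HasGenus S g) (p : Fin n → S) (hp : Function.Injective p)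
    (f : SurfaceBraid.PMod p) (hf : f ∈ SurfaceBraid.PB p) :
    ((max (2 * g) (n - 1) : ℕ) : Cardinal) ≤ SurfaceBraid.kappa p f := by
  -- A class in the kernel of the forgetful map is that of a homeomorphism isotopic to the identity
  -- without regard to the punctures.
  obtain ⟨φ, rfl⟩ := QuotientGroup.mk_surjective f
  obtain ⟨F, hF, hF0, hF1, -⟩ : IsotopicToId (noPoints S) (φ : S ≃ₜ S) :=
    (QuotientGroup.eq_one_iff _).1 hf
  have hX : ∀ x : S, ∃ ψ, IsDiscChart ψ x := exists_isDiscChart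
  have : LocallyPathConnectedSpace S :=
    ChartedSpace.locallyPathConnectedSpace (EuclideanSpace ℝ (Fin 2)) S
  have hR := hS.residueTheorem hX (by omega)
  obtain ⟨ω, hω⟩ := exists_isOrientation hX hR
  have hs : (Set.range p).Finite := Set.finite_range p
  set ι := Hmap ℝ 1 (complInclusion (Set.range p))
  have hinv : ι ∘ₗ homologyAction p φ = ι := by
    change Hmap ℝ 1 (complInclusion (Set.range p)) ∘ₗ Hmap ℝ 1 (restrict p φ φ.2.2) = _
    rw [← Hmap_comp, restrict_comp_complInclusion, Hmap_comp, ← hF1, Hmap_eq_id_of_isotopy hF hF0,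
      LinearMap.id_comp]
  have hker : ∀ v, ι v = 0 → homologyAction p φ v = v := fun v hv =>
    Hmap_eq_self_of_mem_ker hX hω hs hF hF0 (r := restrict p φ φ.2.2)
      (by
        rintro _ ⟨i, rfl⟩
        rw [hF1]
        exact φ.2.2 i)
      (fun y => by rw [hF1]; rfl) hv
  obtain ⟨D, hD, hind⟩ := hS.exists_cocycles
  obtain ⟨U, hU⟩ := exists_dual_independent_of_cocycles hX hs hD hind
  have hrange : ((2 * g : ℕ) : Cardinal) ≤ Module.rank ℝ (LinearMap.range ι) := by
    have := card_le_rank_of_dual_independent (w := fun j => (U j).domRestrict (LinearMap.range ι))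
      fun a ha => hU a (LinearMap.ext fun v => by
        have := LinearMap.congr_fun ha ⟨ι v, v, rfl⟩
        simpa using this)
    simpa [mul_comm] using this
  have hrank := max_rank_le_rank_eqLocus hinv hker hrange
  -- The last puncture serves as the common pole.
  obtain ⟨m, rfl⟩ : ∃ m, n = m + 1 := ⟨n - 1, by omega⟩
  obtain ⟨w, hw⟩ := exists_dual_independent_of_poles hX hR (q := p (Fin.last m))
    (x := fun i : Fin m => p i.castSucc) (hp.comp (Fin.castSucc_injective m))
    (fun i h => (Fin.castSucc_lt_last i).ne (hp h)) hs ⟨_, rfl⟩ (fun i => ⟨_, rfl⟩)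
  have hkerrank : (m : Cardinal) ≤ Module.rank ℝ (LinearMap.ker ι) := by
    have := card_le_rank_of_dual_independent (w := fun j => (w j).domRestrict (LinearMap.ker ι))
      fun a ha => by
        obtain ⟨U', hU'⟩ := exists_linear_comp_eq ι (∑ i, a i • w i) fun v hv => by
          have := LinearMap.congr_fun ha ⟨v, hv⟩
          simpa using this
        exact hw a U' hU'.symm
    simpa using this
  rw [Nat.mono_cast.map_max, Nat.add_sub_cancel]
  exact (max_le_max le_rfl hkerrank).trans hrank
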